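/- Let $\mathbb O=\mathbb R^8$ with coordinates $x^1,\dots,x^8$, let $\Phi$ be the Cayley 4-form $$\Phi= dx^{5678}-dx^{5128}-dx^{5348}-dx^{6138}-dx^{6428}-dx^{7148}-dx^{7238}+dx^{1234}-dx^{3467}-dx^{1267}-dx^{2457}+dx^{1357}-dx^{2356}-dx^{1456},$$ whose stabilizer is $\mathrm{Spin}(7)\subset SO(8)$, and let $\psi_1,\dots,\psi_7$ be the 4-forms that are the imaginary components of the quadruple cross product of which $\Phi$ is the real part: $$\begin{aligned} \psi_1&=dx^{5134}+dx^{5864}+dx^{7123}+dx^{6421}+dx^{1675}+dx^{7538}+dx^{2786}+dx^{4283},\\ \psi_2&=dx^{3612}+dx^{2354}+dx^{4578}+dx^{7214}+dx^{5863}+dx^{3418}+dx^{5762}+dx^{1876},\\ \psi_3&=dx^{7314}+dx^{4821}+dx^{8476}+dx^{6342}+dx^{3756}+dx^{1253}+dx^{1578}+dx^{8256},\\ \psi_4&=dx^{1364}+dx^{6574}+dx^{4521}+dx^{3812}+dx^{2587}+dx^{6518}+dx^{7234}+dx^{6783},\\ \psi_5&=dx^{7352}+dx^{2847}+dx^{6814}+dx^{8632}+dx^{3817}+dx^{1653}+dx^{4571}+dx^{4265},\\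 \psi_6&=dx^{5346}+dx^{6521}+dx^{5328}+dx^{4387}+dx^{1647}+dx^{7128}+dx^{2763}+dx^{4158},\\ \psi_7&=dx^{8463}+dx^{8531}+dx^{6274}+dx^{6137}+dx^{2485}+dx^{3574}+dx^{7521}+dx^{1628}. \end{aligned}$$ A $\mathrm{Spin}(7)$-adapted frame is the image of the standard basis under an element of $\mathrm{Spin}(7)$. For a smooth family $(e_1,\dots,e_8)$ of such frames put $\omega_{ij}=\langle e_i,de_j\rangle$ and $$\zeta_3=\omega_{31}+i\omega_{41},\ \zeta_6=\omega_{61}-i\omega_{71},\ \zeta_5=\omega_{51}-i\omega_{81},\ \zeta_4=\omega_{32}+i\omega_{42},\ \zeta_7=\omega_{62}-i\omega_{72},\ \zeta_8=\omega_{52}-i\omega_{82}.$$ The forms $\zeta_i$ span the $(1,0)$-forms of a $\mathrm{Spin}(7)$-invariant almost complex structure on the Grassmannian $G(2,\mathbb O)$ of oriented 2-planes $e_1\wedge e_2$. Let $\Sigma$ be a Riemann surface, $\gamma:\Sigma\to G(2,\mathbb O)$ a pseudoholomorphic curve (a smooth map that pulls $(1,0)$-forms back to $(1,0)$-forms), and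 let $U\subset\Sigma$ be open with a smooth $\mathrm{Spin}(7)$-adapted framing $(e_1,\dots,e_8)$ over $U$ such that $\gamma=e_1\wedge e_2$. Assume that the asymptotic cone is nowhere flat over $U$: for no nonempty open $V\subset U$ are the planes $\gamma(\sigma)$, $\sigma\in V$, all contained in one linear subspace of dimension at most $4$. For a smooth section $s$ over $U$ of the bundle $\mathcal H$ with fibre $\gamma(\sigma)^\perp$, let $$\mathbf x:\mathbb R^2\times U\to\mathbb O,\qquad \mathbf x(r_1,r_2,\sigma)=s(\sigma)+r_1e_1(\sigma)+r_2e_2(\sigma),$$ and call $\mathbf x$ Cayley if $\mathbf x^*\psi_m=0$ for $m=1,\dots,7$. With $s=\sum_{a=3}^8 s^ae_a$ and $s'^a=ds^a+\sum_{b=3}^8\omega_{ab}s^b$ put $$a_1=s^3+is^4,\quad a_2=s^6-is^7,\quad a_3=s^5-is^8,\qquad \alpha_1=s'^3+is'^4,\quad \alpha_2=s'^6-is'^7,\quad \alpha_3=s'^5-is'^8 .$$ Put $\theta_1=\zeta_3+i\zeta_4$, $\theta_3=\zeta_6+i\zeta_7$, $\theta_5=\zeta_5+i\zeta_8$, $$[\bar\theta_{od}]=\begin{pmatrix}0&\bar\theta_5&-\bar\theta_3\\-\bar\theta_5&0&\bar\theta_1\\\bar\theta_3&-\bar\theta_1&0\end{pmatrix},$$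 $$\kappa=\begin{pmatrix} i\omega_{43} & -(\omega_{63}+i\omega_{64})-\frac{i}{2}\bar{\theta}_5 & -(\omega_{53}+i\omega_{54})+\frac{i}{2}\bar{\theta}_3\\ (\omega_{63}-i\omega_{64})-\frac{i}{2}{\theta}_5&-i\omega_{76}& (\omega_{65}-i\omega_{75})-\frac{i}{2}\bar{\theta}_1\\ (\omega_{53}-i\omega_{54})+\frac{i}{2}{\theta}_3 & -(\omega_{65}+i\omega_{75})-\frac{i}{2}{\theta}_1&i(\omega_{76}-\omega_{43}-\omega_{21}) \end{pmatrix}.$$ Then: 1. $\alpha_i=da_i+\sum_j\kappa_{ij}a_j+\frac i2\sum_j[\bar\theta_{od}]_{ij}\bar a_j$ for $i=1,2,3$. 2. $\mathbf x$ is Cayley if and only if $\psi_m(e_1,e_2,ds,ds)=0$ and $\psi_m(e_1,e_2,de_k,ds)=0$ for $k=1,2$ and all $m$ (equations between 2-forms on $U$). 3. $\mathbf x$ is Cayley if and only if $\alpha_1,\alpha_2,\alpha_3$ are of type $(1,0)$. 4. The set of the sections $s$ for which $\mathbf x$ is Cayley is the kernel of the first-order $\mathbb R$-linear operator $$s\longmapsto\Bigl(\bar\partial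 a_i+\sum_j\pi^{(0,1)}(\kappa_{ij})\,a_j+\tfrac i2\sum_j[\bar\theta_{od}]_{ij}\,\bar a_j\Bigr)_{i=1,2,3},$$ where $\pi^{(0,1)}$ is the projection to forms of type $(0,1)$. -/

import Mathlib

open scoped Manifold ContDiff InnerProductSpace

namespace Cayley

noncomputable section

/-- The octonions as a Euclidean space `ℝ⁸` with coordinates `x¹, …, x⁸`.  The labels `1, …, 8` are
read in `Fin 8`, so the label `8` is the element `0` of `Fin 8`. -/
abbrev Oct : Type := EuclideanSpace ℝ (Fin 8)

/-- The standard basis vector `e⁰ᵢ = ∂/∂xⁱ`. -/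
def stdVec (i : Fin 8) : Oct := EuclideanSpace.single i (1 : ℝ)

/-- The 4-form `dxⁱ ∧ dxʲ ∧ dxᵏ ∧ dxˡ`. -/
def dx (i j k l : Fin 8) (x y z w : Oct) : ℝ :=
  Matrix.det !![x i, y i, z i, w i; x j, y j, z j, w j; x k, y k, z k, w k; x l, y l, z l, w l]

/-- The Cayley 4-form, the real part of the quadruple cross product. -/
def Phi (x y z w : Oct) : ℝ :=
  dx 5 6 7 8 x y z w - dx 5 1 2 8 x y z w - dx 5 3 4 8 x y z w - dx 6 1 3 8 x y z w
  - dx 6 4 2 8 x y z w - dx 7 1 4 8 x y z w - dx 7 2 3 8 x y z w + dx 1 2 3 4 x y z w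
  - dx 3 4 6 7 x y z w - dx 1 2 6 7 x y z w - dx 2 4 5 7 x y z w + dx 1 3 5 7 x y z w
  - dx 2 3 5 6 x y z w - dx 1 4 5 6 x y z w

/-- The 4-forms `ψ₁, …, ψ₇`, the imaginary components of the quadruple cross product;
`psi m` is `ψ_{m+1}` for `m = 0, …, 6`. -/
def psi (m : Fin 7) (x y z w : Oct) : ℝ :=
  ![dx 5 1 3 4 x y z w + dx 5 8 6 4 x y z w + dx 7 1 2 3 x y z w + dx 6 4 2 1 x y z w
      + dx 1 6 7 5 x y z w + dx 7 5 3 8 x y z w + dx 2 7 8 6 x y z w + dx 4 2 8 3 x y z w,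
    dx 3 6 1 2 x y z w + dx 2 3 5 4 x y z w + dx 4 5 7 8 x y z w + dx 7 2 1 4 x y z w
      + dx 5 8 6 3 x y z w + dx 3 4 1 8 x y z w + dx 5 7 6 2 x y z w + dx 1 8 7 6 x y z w,
    dx 7 3 1 4 x y z w + dx 4 8 2 1 x y z w + dx 8 4 7 6 x y z w + dx 6 3 4 2 x y z w
      + dx 3 7 5 6 x y z w + dx 1 2 5 3 x y z w + dx 1 5 7 8 x y z w + dx 8 2 5 6 x y z w,
    dx 1 3 6 4 x y z w + dx 6 5 7 4 x y z w + dx 4 5 2 1 x y z w + dx 3 8 1 2 x y z w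
      + dx 2 5 8 7 x y z w + dx 6 5 1 8 x y z w + dx 7 2 3 4 x y z w + dx 6 7 8 3 x y z w,
    dx 7 3 5 2 x y z w + dx 2 8 4 7 x y z w + dx 6 8 1 4 x y z w + dx 8 6 3 2 x y z w
      + dx 3 8 1 7 x y z w + dx 1 6 5 3 x y z w + dx 4 5 7 1 x y z w + dx 4 2 6 5 x y z w,
    dx 5 3 4 6 x y z w + dx 6 5 2 1 x y z w + dx 5 3 2 8 x y z w + dx 4 3 8 7 x y z w
      + dx 1 6 4 7 x y z w + dx 7 1 2 8 x y z w + dx 2 7 6 3 x y z w + dx 4 1 5 8 x y z w,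
    dx 8 4 6 3 x y z w + dx 8 5 3 1 x y z w + dx 6 2 7 4 x y z w + dx 6 1 3 7 x y z w
      + dx 2 4 8 5 x y z w + dx 3 5 7 4 x y z w + dx 7 5 2 1 x y z w + dx 1 6 2 8 x y z w] m

/-- A `Spin(7)`-adapted frame `(F₁, …, F₈)`: the image of the standard basis under an element of
`Spin(7)`, the stabilizer of `Φ` in the orthogonal group. -/
def IsAdaptedFrame (F : Fin 8 → Oct) : Prop :=
  Orthonormal ℝ F ∧
    ∀ i j k l, Phi (F i) (F j) (F k) (F l) = Phi (stdVec i) (stdVec j) (stdVec k) (stdVec l)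

/-- The bivector `u ∧ v`, as the skew endomorphism `w ↦ ⟨v, w⟩ u - ⟨u, w⟩ v`. -/
def wedge (u v : Oct) : Oct →L[ℝ] Oct :=
  (innerSL ℝ v).smulRight u - (innerSL ℝ u).smulRight v

/-- The Grassmannian `G(2, 𝕆)` of oriented 2-planes, as the set of the bivectors `u ∧ v` of
oriented orthonormal pairs. -/
def Gr : Set (Oct →L[ℝ] Oct) :=
  {B | ∃ u v : Oct, ‖u‖ = 1 ∧ ‖v‖ = 1 ∧ ⟪u, v⟫_ℝ = 0 ∧ B = wedge u v}

/-- The 2-plane `E` underlying a point of `G(2, 𝕆)`. -/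
def plane (B : Oct →L[ℝ] Oct) : Submodule ℝ Oct := LinearMap.range (B : Oct →ₗ[ℝ] Oct)

/-! ### Forms on a Riemann surface -/

section Surface

variable {S : Type*} [TopologicalSpace S] [ChartedSpace ℂ S]

/-- The real tangent space at `p` of a Riemann surface. -/
abbrev Tan (p : S) : Type := TangentSpace 𝓘(ℝ, ℂ) p

/-- The complex structure of the tangent space: multiplication by `i` in the chart at `p`. -/
def rot (p : S) : Tan p →L[ℝ] Tan p :=
  (Complex.I • ContinuousLinearMap.id ℝ ℂ : ℂ →L[ℝ] ℂ)

/-- A complex-valued covector is of type `(1,0)` if it is complex linear. -/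
def IsOneZero {p : S} (b : Tan p →L[ℝ] ℂ) : Prop :=
  ∀ v, b (rot p v) = Complex.I * b v

/-- The projection `π^{(0,1)}` of complex covectors to their part of type `(0,1)`. -/
def piZeroOne {p : S} (b : Tan p →L[ℝ] ℂ) : Tan p →L[ℝ] ℂ :=
  (1 / 2 : ℂ) • (b + Complex.I • b.comp (rot p))

/-- A real covector as a complex one. -/
def toC {p : S} (b : Tan p →L[ℝ] ℝ) : Tan p →L[ℝ] ℂ := Complex.ofRealCLM.comp b

/-- The complex conjugate of a covector. -/
def bar {p : S} (b : Tan p →L[ℝ] ℂ) : Tan p →L[ℝ] ℂ :=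
  (Complex.conjCLE : ℂ →L[ℝ] ℂ).comp b

/-- The differential at `p` of a function with values in a real normed space. -/
def diff {W : Type*} [NormedAddCommGroup W] [NormedSpace ℝ W] (f : S → W) (p : S) :
    Tan p →L[ℝ] W :=
  mfderiv 𝓘(ℝ, ℂ) 𝓘(ℝ, W) f p

/-! ### Pseudoholomorphic curves in the Grassmannian -/

/-- For a frame `F` with `F₁ ∧ F₂ = γ(p)`, the pull-back to `p` of `ω_{j1}` on the Grassmannian:
`dγ = ∑_{j ≥ 3} (ω_{j1} F_j ∧ F₂ + ω_{j2} F₁ ∧ F_j)`, so `ω_{j1} = ⟨F_j, dγ(F₂)⟩`. -/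
def grOne (γ : S → Oct →L[ℝ] Oct) (F : Fin 8 → Oct) (j : Fin 8) (p : S) : Tan p →L[ℝ] ℝ :=
  (innerSL ℝ (F j)).comp ((ContinuousLinearMap.apply ℝ Oct (F 2)).comp (diff γ p))

/-- The pull-back of `ω_{j2} = -⟨F_j, dγ(F₁)⟩`. -/
def grTwo (γ : S → Oct →L[ℝ] Oct) (F : Fin 8 → Oct) (j : Fin 8) (p : S) : Tan p →L[ℝ] ℝ :=
  -((innerSL ℝ (F j)).comp ((ContinuousLinearMap.apply ℝ Oct (F 1)).comp (diff γ p)))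

/-- A smooth map `γ` from a Riemann surface to `G(2, 𝕆)` is a pseudoholomorphic curve if it pulls
back the `(1,0)`-forms of the `Spin(7)`-invariant almost complex structure to `(1,0)`-forms.  In any
adapted frame `F` with `F₁ ∧ F₂ = γ(p)`, these are spanned by
`ζ₃ = ω₃₁ + i ω₄₁`, `ζ₆ = ω₆₁ - i ω₇₁`, `ζ₅ = ω₅₁ - i ω₈₁`,
`ζ₄ = ω₃₂ + i ω₄₂`, `ζ₇ = ω₆₂ - i ω₇₂`, `ζ₈ = ω₅₂ - i ω₈₂`. -/
def IsPseudoholomorphic (γ : S → Oct →L[ℝ] Oct) : Prop :=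
  ContMDiff 𝓘(ℝ, ℂ) 𝓘(ℝ, Oct →L[ℝ] Oct) ∞ γ ∧ (∀ p, γ p ∈ Gr) ∧
    ∀ (p : S) (F : Fin 8 → Oct), IsAdaptedFrame F → wedge (F 1) (F 2) = γ p →
      IsOneZero (toC (grOne γ F 3 p) + Complex.I • toC (grOne γ F 4 p)) ∧
      IsOneZero (toC (grOne γ F 6 p) - Complex.I • toC (grOne γ F 7 p)) ∧
      IsOneZero (toC (grOne γ F 5 p) - Complex.I • toC (grOne γ F 8 p)) ∧
      IsOneZero (toC (grTwo γ F 3 p) + Complex.I • toC (grTwo γ F 4 p)) ∧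
      IsOneZero (toC (grTwo γ F 6 p) - Complex.I • toC (grTwo γ F 7 p)) ∧
      IsOneZero (toC (grTwo γ F 5 p) - Complex.I • toC (grTwo γ F 8 p))

/-- The planes `γ(p)`, `p ∈ V`, lie in one linear subspace of dimension at most four. -/
def IsFlatOn (γ : S → Oct →L[ℝ] Oct) (V : Set S) : Prop :=
  ∃ P : Submodule ℝ Oct, Module.finrank ℝ P ≤ 4 ∧ ∀ p ∈ V, plane (γ p) ≤ P

/-- A smooth `Spin(7)`-adapted framing `(e₁, …, e₈)` over the open set `U` with `γ = e₁ ∧ e₂`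
(its values off `U` are irrelevant). -/
structure AdaptedFraming (γ : S → Oct →L[ℝ] Oct) (U : TopologicalSpace.Opens S) where
  vec : S → Fin 8 → Oct
  smooth : ∀ i, ContMDiffOn 𝓘(ℝ, ℂ) 𝓘(ℝ, Oct) ∞ (fun p => vec p i) U
  adapted : ∀ p ∈ U, IsAdaptedFrame (vec p)
  span : ∀ p ∈ U, wedge (vec p 1) (vec p 2) = γ p

/-- Smooth sections over `U` of the bundle `γ^* H`, where `H = E^⊥` (values off `U` are
irrelevant). -/
def sectionsH (γ : S → Oct →L[ℝ] Oct) (U : TopologicalSpace.Opens S) : Submodule ℝ (S → Oct) where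
  carrier := {s | ContMDiffOn 𝓘(ℝ, ℂ) 𝓘(ℝ, Oct) ∞ s U ∧ ∀ p ∈ U, s p ∈ (plane (γ p))ᗮ}
  zero_mem' := ⟨contMDiffOn_const, fun _ _ => Submodule.zero_mem _⟩
  add_mem' := fun hs ht =>
    ⟨hs.1.add ht.1, fun p hp => Submodule.add_mem _ (hs.2 p hp) (ht.2 p hp)⟩
  smul_mem' := fun c _ hs =>
    ⟨fun p hp => (contDiff_const_smul c).contMDiff.contMDiffAt.comp_contMDiffWithinAt p (hs.1 p hp),
      fun p hp => Submodule.smul_mem _ c (hs.2 p hp)⟩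

/-! ### The forms of an adapted framing -/

namespace AdaptedFraming

variable {γ : S → Oct →L[ℝ] Oct} {U : TopologicalSpace.Opens S} (e : AdaptedFraming γ U)

/-- The connection forms `ω_{ij} = ⟨e_i, de_j⟩`, so that `de_j = e_i ω_{ij}`. -/
def conn (i j : Fin 8) (p : S) : Tan p →L[ℝ] ℝ :=
  (innerSL ℝ (e.vec p i)).comp (diff (fun q => e.vec q j) p)

/-- `ω_{ij}` as a complex form. -/
def connC (i j : Fin 8) (p : S) : Tan p →L[ℝ] ℂ := toC (e.conn i j p)

def zeta3 (p : S) : Tan p →L[ℝ] ℂ := e.connC 3 1 p + Complex.I • e.connC 4 1 p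
def zeta4 (p : S) : Tan p →L[ℝ] ℂ := e.connC 3 2 p + Complex.I • e.connC 4 2 p
def zeta6 (p : S) : Tan p →L[ℝ] ℂ := e.connC 6 1 p - Complex.I • e.connC 7 1 p
def zeta7 (p : S) : Tan p →L[ℝ] ℂ := e.connC 6 2 p - Complex.I • e.connC 7 2 p
def zeta5 (p : S) : Tan p →L[ℝ] ℂ := e.connC 5 1 p - Complex.I • e.connC 8 1 p
def zeta8 (p : S) : Tan p →L[ℝ] ℂ := e.connC 5 2 p - Complex.I • e.connC 8 2 p

def theta1 (p : S) : Tan p →L[ℝ] ℂ := e.zeta3 p + Complex.I • e.zeta4 p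
def theta3 (p : S) : Tan p →L[ℝ] ℂ := e.zeta6 p + Complex.I • e.zeta7 p
def theta5 (p : S) : Tan p →L[ℝ] ℂ := e.zeta5 p + Complex.I • e.zeta8 p

/-- The matrix `κ` of complex 1-forms. -/
def kappa (p : S) : Matrix (Fin 3) (Fin 3) (Tan p →L[ℝ] ℂ) :=
  !![Complex.I • e.connC 4 3 p,
     -(e.connC 6 3 p + Complex.I • e.connC 6 4 p) - (Complex.I / 2) • bar (e.theta5 p),
     -(e.connC 5 3 p + Complex.I • e.connC 5 4 p) + (Complex.I / 2) • bar (e.theta3 p);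
     (e.connC 6 3 p - Complex.I • e.connC 6 4 p) - (Complex.I / 2) • e.theta5 p,
     -(Complex.I • e.connC 7 6 p),
     (e.connC 6 5 p - Complex.I • e.connC 7 5 p) - (Complex.I / 2) • bar (e.theta1 p);
     (e.connC 5 3 p - Complex.I • e.connC 5 4 p) + (Complex.I / 2) • e.theta3 p,
     -(e.connC 6 5 p + Complex.I • e.connC 7 5 p) - (Complex.I / 2) • e.theta1 p,
     Complex.I • (e.connC 7 6 p - e.connC 4 3 p - e.connC 2 1 p)]

/-- The matrix `[θ̄_od]`, where `θ_od = (θ₁, θ₃, θ₅)` and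
`[v] = (0, v₃, -v₂; -v₃, 0, v₁; v₂, -v₁, 0)`. -/
def bracketThetaBar (p : S) : Matrix (Fin 3) (Fin 3) (Tan p →L[ℝ] ℂ) :=
  !![0, bar (e.theta5 p), -bar (e.theta3 p);
     -bar (e.theta5 p), 0, bar (e.theta1 p);
     bar (e.theta3 p), -bar (e.theta1 p), 0]

/-- The component `s^a = ⟨e_a, s⟩`. -/
def comp (s : S → Oct) (a : Fin 8) (p : S) : ℝ := ⟪e.vec p a, s p⟫_ℝ

/-- `a₁ = s³ + i s⁴`, `a₂ = s⁶ - i s⁷`, `a₃ = s⁵ - i s⁸`. -/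
def coef (s : S → Oct) (i : Fin 3) (p : S) : ℂ :=
  ![(e.comp s 3 p : ℂ) + Complex.I * (e.comp s 4 p : ℂ),
    (e.comp s 6 p : ℂ) - Complex.I * (e.comp s 7 p : ℂ),
    (e.comp s 5 p : ℂ) - Complex.I * (e.comp s 8 p : ℂ)] i

/-- The 1-form `s'^a = ds^a + ∑_{b = 3}^{8} ω_{ab} s^b`, as a complex form. -/
def sPrime (s : S → Oct) (a : Fin 8) (p : S) : Tan p →L[ℝ] ℂ :=
  toC (diff (e.comp s a) p + ∑ b ∈ ({3, 4, 5, 6, 7, 8} : Finset (Fin 8)), e.comp s b p • e.conn a b p)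

/-- `α₁ = s'³ + i s'⁴`, `α₂ = s'⁶ - i s'⁷`, `α₃ = s'⁵ - i s'⁸`. -/
def alpha (s : S → Oct) (i : Fin 3) (p : S) : Tan p →L[ℝ] ℂ :=
  ![e.sPrime s 3 p + Complex.I • e.sPrime s 4 p,
    e.sPrime s 6 p - Complex.I • e.sPrime s 7 p,
    e.sPrime s 5 p - Complex.I • e.sPrime s 8 p] i

/-- The 2-ruled 4-fold `x(r₁, r₂, σ) = r₁ e₁ + r₂ e₂ + s`. -/
def ruled (s : S → Oct) (q : ℝ × ℝ × S) : Oct :=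
  q.1 • e.vec q.2.2 1 + q.2.1 • e.vec q.2.2 2 + s q.2.2

/-- `x : ℝ² × U → 𝕆` is Cayley: `x^* ψ_m = 0` for all `m`.  (Where `x` is not an immersion, the
pull-back of a 4-form to this 4-dimensional domain vanishes, so this says exactly that `x` is a
Cayley 4-fold wherever it is an immersion.) -/
def IsCayley (s : S → Oct) : Prop :=
  ∀ q : ℝ × ℝ × S, q.2.2 ∈ U → ∀ m : Fin 7,
    ∀ v : Fin 4 → TangentSpace (𝓘(ℝ, ℝ).prod (𝓘(ℝ, ℝ).prod 𝓘(ℝ, ℂ))) q,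
      let D : _ →L[ℝ] Oct := mfderiv (𝓘(ℝ, ℝ).prod (𝓘(ℝ, ℝ).prod 𝓘(ℝ, ℂ))) 𝓘(ℝ, Oct) (e.ruled s) q
      psi m (D (v 0)) (D (v 1)) (D (v 2)) (D (v 3)) = 0

/-- The reduced equations `ψ_m(e₁, e₂, ds, ds) = 0`, `ψ_m(e₁, e₂, de_i, ds) = 0` (`i = 1, 2`)
between 2-forms on `U`. -/
def ReducedEquations (s : S → Oct) : Prop :=
  ∀ p ∈ U, ∀ (m : Fin 7) (u v : Tan p),
    psi m (e.vec p 1) (e.vec p 2) (diff s p u) (diff s p v) = 0 ∧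
    ∀ i ∈ ({1, 2} : Finset (Fin 8)),
      psi m (e.vec p 1) (e.vec p 2) (diff (fun q => e.vec q i) p u) (diff s p v)
        - psi m (e.vec p 1) (e.vec p 2) (diff (fun q => e.vec q i) p v) (diff s p u) = 0

theorem contMDiffOn_comp (s : sectionsH γ U) (a : Fin 8) :
    ContMDiffOn 𝓘(ℝ, ℂ) 𝓘(ℝ, ℝ) ∞ (e.comp s.1 a) U := by
  intro p hp
  have h1 := e.smooth a p hp
  have h2 := s.2.1 p hp
  have h3 : ContDiff ℝ ∞ (fun x : Oct × Oct => ⟪x.1, x.2⟫_ℝ) := contDiff_fst.inner ℝ contDiff_snd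
  exact h3.contMDiff.contMDiffAt.comp_contMDiffWithinAt p (h1.prodMk_space h2)

theorem contMDiffOn_coef (s : sectionsH γ U) (i : Fin 3) :
    ContMDiffOn 𝓘(ℝ, ℂ) 𝓘(ℝ, ℂ) ∞ (e.coef s.1 i) U := by
  have key : ∀ (a b : Fin 8) (c : ℂ), ContMDiffOn 𝓘(ℝ, ℂ) 𝓘(ℝ, ℂ) ∞
      (fun p => (e.comp s.1 a p : ℂ) + c * (e.comp s.1 b p : ℂ)) U := by
    intro a b c p hp
    have h3 : ContDiff ℝ ∞ (fun x : ℝ × ℝ => (x.1 : ℂ) + c * (x.2 : ℂ)) :=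
      (Complex.ofRealCLM.contDiff.comp contDiff_fst).add
        (contDiff_const.mul (Complex.ofRealCLM.contDiff.comp contDiff_snd))
    exact h3.contMDiff.contMDiffAt.comp_contMDiffWithinAt p
      ((e.contMDiffOn_comp s a p hp).prodMk_space (e.contMDiffOn_comp s b p hp))
  fin_cases i
  · exact key 3 4 Complex.I
  · refine (key 6 7 (-Complex.I)).congr fun p _ => ?_
    simp [coef, sub_eq_add_neg]
  · refine (key 5 8 (-Complex.I)).congr fun p _ => ?_
    simp [coef, sub_eq_add_neg]

theorem coef_add (s t : S → Oct) (i : Fin 3) : e.coef (s + t) i = e.coef s i + e.coef t i := by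
  funext p
  fin_cases i <;> simp [coef, comp, inner_add_right] <;> ring

theorem coef_smul (c : ℝ) (s : S → Oct) (i : Fin 3) : e.coef (c • s) i = c • e.coef s i := by
  funext p
  fin_cases i <;> simp [coef, comp, inner_smul_right] <;> ring

theorem mdiff_coef (s : sectionsH γ U) (i : Fin 3) {p : S} (hp : p ∈ U) :
    MDifferentiableAt 𝓘(ℝ, ℂ) 𝓘(ℝ, ℂ) (e.coef s.1 i) p :=
  ((e.contMDiffOn_coef s i).contMDiffAt (U.isOpen.mem_nhds hp)).mdifferentiableAt (by simp)

/-- The first-order real-linear operator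
`s ↦ ∂̄a_i + π^{(0,1)}(κ_ij) a_j + (i/2) [θ̄_od]_ij ā_j`
from sections of `H` over `U` to triples of complex 1-forms on `U`. -/
def dbarOperator :
    sectionsH γ U →ₗ[ℝ] ((p : U) → Fin 3 → (Tan (p : S) →L[ℝ] ℂ)) where
  toFun s := fun p i =>
    piZeroOne (diff (e.coef s.1 i) (p : S))
      + ∑ j, e.coef s.1 j p • piZeroOne (e.kappa p i j)
      + (Complex.I / 2) • ∑ j, (starRingEnd ℂ) (e.coef s.1 j p) • e.bracketThetaBar p i j
  map_add' s t := by
    funext p i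
    have h : diff (e.coef s.1 i + e.coef t.1 i) (p : S)
        = diff (e.coef s.1 i) (p : S) + diff (e.coef t.1 i) (p : S) := by
      exact mfderiv_add (e.mdiff_coef s i p.2) (e.mdiff_coef t i p.2)
    ext v
    simp [h, coef_add, piZeroOne, Finset.sum_add_distrib, Fin.sum_univ_three]
    ring
  map_smul' c s := by
    funext p i
    have h : diff (c • e.coef s.1 i) (p : S) = c • diff (e.coef s.1 i) (p : S) := by
      exact const_smul_mfderiv (e.mdiff_coef s i p.2) c
    ext v
    simp [h, coef_smul, piZeroOne, Fin.sum_univ_three]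
    ring

end AdaptedFraming

end Surface

end

end Cayley

/-!
In an adapted frame the vectors normal to `e₁ ∧ e₂` are read as elements of `ℂ³`, and there the
forms `ψ_m(e₁, e₂, ·, ·)` become the complex cross product.  The velocity of an adapted frame lies
in `𝔰𝔭𝔦𝔫(7)`; the seven linear relations among its entries are what puts the derivative of a normal
section in the form `da + κ a + (i/2) [θ̄] ā`.

For a pseudoholomorphic curve the normal parts of `de₁` and `de₂` are complex linear on tangent
vectors, so the terms of `x^*ψ` that are quadratic in `r₁, r₂` vanish, and the Cayley condition says
that the cross products of the normal part of `ds` with itself and with those of `de₁`, `de₂`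
vanish.  If moreover the normal part of `ds` is not of type `(1,0)` at some point, then near that
point the normal parts of `de₁`, `de₂` and `ds` are all multiples of a single direction `b ∈ ℂ³`.
The relations `d(de₁) = d(de₂) = d(ds) = 0` then make the four-dimensional space spanned by
`e₁, e₂, b, ib` locally constant, against the assumption that the asymptotic cone is nowhere flat.
-/

namespace Cayley

open Filter Topology
open scoped Matrix

noncomputable section

/-! ### Derivations of alternating maps -/

section Alternating

variable {R M N ι : Type*} [CommRing R] [AddCommGroup M] [Module R M] [AddCommGroup N] [Module R N]

theorem compLinearMap_update_id_apply [DecidableEq ι] (f : MultilinearMap R (fun _ : ι => M) N)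
    (A : M →ₗ[R] M) (k : ι) (v : ι → M) :
    f.compLinearMap (Function.update (fun _ => LinearMap.id) k A) v
      = f (Function.update v k (A (v k))) := by
  refine congrArg f (funext fun j => ?_)
  rcases eq_or_ne j k with rfl | h
  · simp
  · simp [h]

/-- The alternating map `v ↦ ∑ f(v₁, …, A vᵢ, …, vₙ)`: the value at `A` of `derivationAction`. -/
def sumUpdate [Fintype ι] [DecidableEq ι] (f : M [⋀^ι]→ₗ[R] N) (A : M →ₗ[R] M) :
    M [⋀^ι]→ₗ[R] N where
  toMultilinearMap :=
    ∑ i, f.toMultilinearMap.compLinearMap (Function.update (fun _ => LinearMap.id) i A)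
  map_eq_zero_of_eq' v i j hv hij := by
    simp only [MultilinearMap.toFun_eq_coe, sum_apply, compLinearMap_update_id_apply,
      AlternatingMap.coe_multilinearMap]
    rw [Fintype.sum_eq_add i j hij]
    · have swap : Function.update v j (A (v j))
          = Function.update v i (A (v i)) ∘ Equiv.swap i j := by
        funext k
        rcases eq_or_ne k i with rfl | hi
        · simp [hij, hij.symm, hv]
        · rcases eq_or_ne k j with rfl | hj
          · simp [hv]
          · simp [hi, hj, Equiv.swap_apply_of_ne_of_ne]
      rw [swap, f.map_swap _ hij, add_neg_cancel]
    · rintro k ⟨hi, hj⟩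
      exact f.map_eq_zero_of_eq _ (by simp [hi.symm, hj.symm, hv]) hij

theorem sumUpdate_apply [Fintype ι] [DecidableEq ι] (f : M [⋀^ι]→ₗ[R] N) (A : M →ₗ[R] M)
    (v : ι → M) : sumUpdate f A v = ∑ i, f (Function.update v i (A (v i))) := by
  change (∑ i, f.toMultilinearMap.compLinearMap _ : MultilinearMap R _ N) v = _
  simp only [sum_apply, compLinearMap_update_id_apply, AlternatingMap.coe_multilinearMap]

/-- The action `A ↦ A · f` of the endomorphisms of a module on an alternating map by derivations,
`(A · f)(v₁, …, vₙ) = ∑ f(v₁, …, A vᵢ, …, vₙ)`. -/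
def derivationAction [Fintype ι] [DecidableEq ι] (f : M [⋀^ι]→ₗ[R] N) :
    (M →ₗ[R] M) →ₗ[R] M [⋀^ι]→ₗ[R] N where
  toFun := sumUpdate f
  map_add' A B := by ext v; simp [sumUpdate_apply, Finset.sum_add_distrib]
  map_smul' c A := by ext v; simp [sumUpdate_apply, Finset.smul_sum]

theorem derivationAction_apply [Fintype ι] [DecidableEq ι] (f : M [⋀^ι]→ₗ[R] N) (A : M →ₗ[R] M)
    (v : ι → M) : derivationAction f A v = ∑ i, f (Function.update v i (A (v i))) :=
  sumUpdate_apply f A v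

theorem derivationAction_conj [Fintype ι] [DecidableEq ι] (g : M ≃ₗ[R] M) (A : M →ₗ[R] M)
    {f : M [⋀^ι]→ₗ[R] N} (hg : f.compLinearMap g.toLinearMap = f) :
    derivationAction f (g.symm.toLinearMap ∘ₗ A ∘ₗ g.toLinearMap)
      = (derivationAction f A).compLinearMap g.toLinearMap := by
  ext v
  simp only [derivationAction_apply, AlternatingMap.compLinearMap_apply]
  refine Finset.sum_congr rfl fun i _ => ?_
  nth_rw 1 [← hg]
  refine congrArg f (funext fun j => ?_)
  rcases eq_or_ne j i with rfl | h
  · simp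
  · simp [h]

theorem alternatingMap_ext_of_strictMono [LinearOrder ι] {n : ℕ} (b : Module.Basis ι R M)
    {f g : M [⋀^Fin n]→ₗ[R] N}
    (h : ∀ t : Fin n → ι, StrictMono t → f (fun i => b (t i)) = g (fun i => b (t i))) : f = g := by
  refine Module.Basis.ext_alternating b fun t ht => ?_
  have hs := h (t ∘ Tuple.sort t)
    ((Tuple.monotone_sort t).strictMono_of_injective (ht.comp (Tuple.sort t).injective))
  have hf := f.map_perm (fun i => b (t i)) (Tuple.sort t)
  have hg := g.map_perm (fun i => b (t i)) (Tuple.sort t)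
  simp only [Function.comp_def] at hs hf hg
  rw [hf, hg] at hs
  exact MulAction.injective _ hs

end Alternating

/-! ### The Cayley form and its companions in the standard basis -/

/-- The signed sum of the terms `d i j k l` that makes up the Cayley form when `d i j k l` is
`dxⁱʲᵏˡ`; it is stated for arbitrary values, so as to cover the components of the form as well. -/
def cayleySum {M : Type*} [AddCommGroup M] (d : Fin 8 → Fin 8 → Fin 8 → Fin 8 → M) : M :=
  d 5 6 7 8 - d 5 1 2 8 - d 5 3 4 8 - d 6 1 3 8 - d 6 4 2 8 - d 7 1 4 8 - d 7 2 3 8 + d 1 2 3 4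
  - d 3 4 6 7 - d 1 2 6 7 - d 2 4 5 7 + d 1 3 5 7 - d 2 3 5 6 - d 1 4 5 6

/-- The sum of the terms `d i j k l` that makes up `ψ_{m+1}` when `d i j k l` is `dxⁱʲᵏˡ`. -/
def psiSum {M : Type*} [AddCommGroup M] (d : Fin 8 → Fin 8 → Fin 8 → Fin 8 → M) : Fin 7 → M :=
  ![d 5 1 3 4 + d 5 8 6 4 + d 7 1 2 3 + d 6 4 2 1 + d 1 6 7 5 + d 7 5 3 8 + d 2 7 8 6 + d 4 2 8 3,
    d 3 6 1 2 + d 2 3 5 4 + d 4 5 7 8 + d 7 2 1 4 + d 5 8 6 3 + d 3 4 1 8 + d 5 7 6 2 + d 1 8 7 6,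
    d 7 3 1 4 + d 4 8 2 1 + d 8 4 7 6 + d 6 3 4 2 + d 3 7 5 6 + d 1 2 5 3 + d 1 5 7 8 + d 8 2 5 6,
    d 1 3 6 4 + d 6 5 7 4 + d 4 5 2 1 + d 3 8 1 2 + d 2 5 8 7 + d 6 5 1 8 + d 7 2 3 4 + d 6 7 8 3,
    d 7 3 5 2 + d 2 8 4 7 + d 6 8 1 4 + d 8 6 3 2 + d 3 8 1 7 + d 1 6 5 3 + d 4 5 7 1 + d 4 2 6 5,
    d 5 3 4 6 + d 6 5 2 1 + d 5 3 2 8 + d 4 3 8 7 + d 1 6 4 7 + d 7 1 2 8 + d 2 7 6 3 + d 4 1 5 8,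
    d 8 4 6 3 + d 8 5 3 1 + d 6 2 7 4 + d 6 1 3 7 + d 2 4 8 5 + d 3 5 7 4 + d 7 5 2 1 + d 1 6 2 8]

/-- `dxⁱ ∧ dxʲ ∧ dxᵏ ∧ dxˡ` as an alternating map. -/
def dxAlt (i j k l : Fin 8) : Oct [⋀^Fin 4]→ₗ[ℝ] ℝ :=
  (Matrix.detRowAlternating (n := Fin 4) (R := ℝ)).compLinearMap
    (LinearMap.pi fun r : Fin 4 =>
      (EuclideanSpace.proj (![i, j, k, l] r) : Oct →L[ℝ] ℝ).toLinearMap)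

theorem dxAlt_apply (i j k l : Fin 8) (v : Fin 4 → Oct) :
    dxAlt i j k l v = dx i j k l (v 0) (v 1) (v 2) (v 3) := by
  change Matrix.det (Matrix.of fun a b => v a (![i, j, k, l] b)) = _
  rw [← Matrix.det_transpose, dx]
  congr 1
  ext a b
  fin_cases a <;> fin_cases b <;> rfl

/-- The Cayley form as an alternating map. -/
def PhiAlt : Oct [⋀^Fin 4]→ₗ[ℝ] ℝ := cayleySum dxAlt

theorem PhiAlt_apply (v : Fin 4 → Oct) : PhiAlt v = Phi (v 0) (v 1) (v 2) (v 3) := by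
  simp only [PhiAlt, cayleySum, Phi, AlternatingMap.sub_apply, AlternatingMap.add_apply,
    dxAlt_apply]

/-- The form `ψ_{m+1}` as an alternating map. -/
def psiAlt (m : Fin 7) : Oct [⋀^Fin 4]→ₗ[ℝ] ℝ := psiSum dxAlt m

theorem psiAlt_apply (m : Fin 7) (v : Fin 4 → Oct) :
    psiAlt m v = psi m (v 0) (v 1) (v 2) (v 3) := by
  fin_cases m <;> simp [psiAlt, psiSum, psi, dxAlt_apply]

/-- `x` if the labels agree and `0` otherwise. -/
def pick (i a : Fin 8) (x : ℤ) : ℤ := if i = a then x else 0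

/-- The value of `dxᵏ ∧ dxˡ` on the standard basis vectors with labels `c, d`. -/
def dxTwoStd (k l c d : Fin 8) : ℤ := pick k c (pick l d 1) - pick k d (pick l c 1)

/-- The value of `dxʲ ∧ dxᵏ ∧ dxˡ` on the standard basis vectors with labels `b, c, d`. -/
def dxThreeStd (j k l b c d : Fin 8) : ℤ :=
  pick j b (dxTwoStd k l c d) - pick j c (dxTwoStd k l b d) + pick j d (dxTwoStd k l b c)

/-- The value of `dxⁱ ∧ dxʲ ∧ dxᵏ ∧ dxˡ` on the standard basis vectors with labels `a, b, c, d`. -/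
def dxStd (a b c d i j k l : Fin 8) : ℤ :=
  pick i a (dxThreeStd j k l b c d) - pick i b (dxThreeStd j k l a c d)
    + pick i c (dxThreeStd j k l a b d) - pick i d (dxThreeStd j k l a b c)

/-- The components of `Φ` in the standard basis. -/
def PhiStd (a b c d : Fin 8) : ℤ := cayleySum (dxStd a b c d)

/-- The components of `ψ_{m+1}` in the standard basis. -/
def psiStd (m : Fin 7) (a b c d : Fin 8) : ℤ := psiSum (dxStd a b c d) m

theorem stdVec_apply (a i : Fin 8) : stdVec a i = if i = a then 1 else 0 := by
  simp [stdVec]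

theorem inner_stdVec (a : Fin 8) (x : Oct) : ⟪stdVec a, x⟫_ℝ = x a := by
  simp [stdVec, EuclideanSpace.inner_single_left]

theorem pick_cast (i a : Fin 8) (x : ℤ) : ((pick i a x : ℤ) : ℝ) = stdVec a i * x := by
  rw [stdVec_apply, pick]; split_ifs <;> simp

theorem dx_stdVec (i j k l a b c d : Fin 8) :
    dx i j k l (stdVec a) (stdVec b) (stdVec c) (stdVec d) = dxStd a b c d i j k l := by
  simp only [dxStd, dxThreeStd, dxTwoStd, Int.cast_sub, Int.cast_add, pick_cast, Int.cast_one, dx,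
    Matrix.det_succ_row_zero, Fin.sum_univ_succ]
  simp [Fin.succAbove, Matrix.submatrix]
  ring

theorem Phi_stdVec (a b c d : Fin 8) :
    Phi (stdVec a) (stdVec b) (stdVec c) (stdVec d) = PhiStd a b c d := by
  simp only [Phi, PhiStd, cayleySum, dx_stdVec, Int.cast_sub, Int.cast_add]

theorem psi_stdVec (m : Fin 7) (a b c d : Fin 8) :
    psi m (stdVec a) (stdVec b) (stdVec c) (stdVec d) = psiStd m a b c d := by
  fin_cases m <;> simp [psi, psiStd, psiSum, dx_stdVec]

theorem exists_psiStd_eq_ite : ∃ t : Fin 7 → Fin 4 → Fin 8, ∀ m n,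
    psiStd m (t n 0) (t n 1) (t n 2) (t n 3) = if m = n then 1 else 0 :=
  ⟨![![5, 1, 3, 4], ![3, 6, 1, 2], ![7, 3, 1, 4], ![1, 3, 6, 4], ![7, 3, 5, 2], ![5, 3, 4, 6],
    ![8, 4, 6, 3]], by decide +kernel⟩

theorem linearIndependent_psiAlt : LinearIndependent ℝ psiAlt := by
  obtain ⟨t, ht⟩ := exists_psiStd_eq_ite
  rw [Fintype.linearIndependent_iff]
  intro c hc n
  rw [Fin.sum_univ_seven] at hc
  have h := DFunLike.congr_fun hc fun i => stdVec (t n i)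
  fin_cases n <;> simpa [psiAlt_apply, psi_stdVec, ht] using h

/-! ### The orthogonal complement of `𝔰𝔭𝔦𝔫(7)` in `𝔰𝔬(8)` -/

/-- The components of seven 2-forms that span the orthogonal complement of `𝔰𝔭𝔦𝔫(7)` in
`𝔰𝔬(8) = Λ²ℝ⁸`. -/
def complStd (m : Fin 7) (a b : Fin 8) : ℤ :=
  ![dxTwoStd 1 8 a b - dxTwoStd 2 5 a b - dxTwoStd 3 6 a b - dxTwoStd 4 7 a b,
    dxTwoStd 1 5 a b + dxTwoStd 2 8 a b - dxTwoStd 3 7 a b + dxTwoStd 4 6 a b,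
    dxTwoStd 1 6 a b + dxTwoStd 2 7 a b + dxTwoStd 3 8 a b - dxTwoStd 4 5 a b,
    dxTwoStd 1 7 a b - dxTwoStd 2 6 a b + dxTwoStd 3 5 a b + dxTwoStd 4 8 a b,
    -dxTwoStd 1 2 a b - dxTwoStd 3 4 a b + dxTwoStd 5 8 a b + dxTwoStd 6 7 a b,
    -dxTwoStd 1 3 a b + dxTwoStd 2 4 a b - dxTwoStd 5 7 a b + dxTwoStd 6 8 a b,
    -dxTwoStd 1 4 a b - dxTwoStd 2 3 a b + dxTwoStd 5 6 a b + dxTwoStd 7 8 a b] m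

/-- The coefficient of `A_{ab}` in the component `i, j, k, l` of `A · Φ`. -/
def derivationCoeff (i j k l a b : Fin 8) : ℤ :=
  pick i b (PhiStd a j k l) + pick j b (PhiStd i a k l) + pick k b (PhiStd i j a l)
    + pick l b (PhiStd i j k a)

theorem derivationCoeff_sub_of_lt : ∀ i j : Fin 8, i < j → ∀ k, j < k → ∀ l, k < l → ∀ a b, a < b →
    derivationCoeff i j k l a b - derivationCoeff i j k l b a
      = ∑ n, complStd n a b * psiStd n i j k l := by
  decide +kernel

theorem derivationAction_wedge_stdVec_of_lt {a b : Fin 8} (hab : a < b) :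
    derivationAction PhiAlt (wedge (stdVec a) (stdVec b)).toLinearMap
      = ∑ n, (complStd n a b : ℝ) • psiAlt n := by
  refine alternatingMap_ext_of_strictMono (EuclideanSpace.basisFun (Fin 8) ℝ).toBasis fun t ht => ?_
  have h := congrArg (Int.cast (R := ℝ)) (derivationCoeff_sub_of_lt (t 0) (t 1) (ht (by decide))
    (t 2) (ht (by decide)) (t 3) (ht (by decide)) a b hab)
  have hw : ∀ i, wedge (stdVec a) (stdVec b) (stdVec i)
      = stdVec b i • stdVec a - stdVec a i • stdVec b := fun i => by
    simp [wedge, inner_stdVec, stdVec_apply, eq_comm]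
  simp only [Fin.sum_univ_seven, Int.cast_sub, Int.cast_mul, derivationCoeff, Int.cast_add,
    pick_cast, ← Phi_stdVec, ← psi_stdVec] at h
  have hb : ∀ i, (EuclideanSpace.basisFun (Fin 8) ℝ).toBasis (t i) = stdVec (t i) := fun i => by
    simp [stdVec]
  simp only [hb, derivationAction_apply, Fin.sum_univ_four, ContinuousLinearMap.coe_coe, hw,
    AlternatingMap.map_update_sub, AlternatingMap.map_update_smul, Fin.sum_univ_seven,
    AlternatingMap.add_apply, AlternatingMap.smul_apply, psiAlt_apply, PhiAlt_apply, smul_eq_mul,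
    ← h]
  simp
  ring

theorem wedge_swap (u v : Oct) : wedge u v = -wedge v u := by
  simp [wedge]

theorem complStd_swap : ∀ (m : Fin 7) (a b : Fin 8), complStd m a b = -complStd m b a := by
  decide +kernel

theorem derivationAction_wedge_stdVec (a b : Fin 8) :
    derivationAction PhiAlt (wedge (stdVec a) (stdVec b)).toLinearMap
      = ∑ n, (complStd n a b : ℝ) • psiAlt n := by
  rcases lt_trichotomy a b with h | rfl | h
  · exact derivationAction_wedge_stdVec_of_lt h
  · have h0 : ∀ n, complStd n a a = 0 := fun n => by have := complStd_swap n a a; omega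
    simp [h0, wedge]
  · rw [wedge_swap, ContinuousLinearMap.toLinearMap_neg, map_neg,
      derivationAction_wedge_stdVec_of_lt h, ← Finset.sum_neg_distrib]
    refine Finset.sum_congr rfl fun n _ => ?_
    rw [complStd_swap n a, Int.cast_neg]
    exact (neg_smul _ _).symm

theorem psiAlt_eq_derivationAction (m : Fin 7) :
    ∃ a b, psiAlt m = derivationAction PhiAlt (wedge (stdVec a) (stdVec b)).toLinearMap := by
  have h : ∃ a b, ∀ n, complStd n a b = if n = m then 1 else 0 := by
    revert m; decide +kernel
  obtain ⟨a, b, hab⟩ := h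
  refine ⟨a, b, ?_⟩
  simp [derivationAction_wedge_stdVec, hab]

theorem two_smul_eq_sum_wedge {ι : Type*} [Fintype ι] (b : OrthonormalBasis ι ℝ Oct)
    {A : Oct →ₗ[ℝ] Oct} (hA : ∀ x y, ⟪A x, y⟫_ℝ = -⟪x, A y⟫_ℝ) :
    (2 : ℝ) • A = ∑ i, ∑ j, ⟪b i, A (b j)⟫_ℝ • (wedge (b i) (b j)).toLinearMap := by
  ext1 x
  have rows : ∑ i, ∑ j, (⟪b i, A (b j)⟫_ℝ * ⟪b j, x⟫_ℝ) • b i = A x := by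
    rw [Finset.sum_comm]
    calc ∑ j, ∑ i, (⟪b i, A (b j)⟫_ℝ * ⟪b j, x⟫_ℝ) • b i
        = ∑ j, ⟪b j, x⟫_ℝ • ∑ i, ⟪b i, A (b j)⟫_ℝ • b i := by
          simp only [Finset.smul_sum, smul_smul, mul_comm]
      _ = A (∑ j, ⟪b j, x⟫_ℝ • b j) := by simp only [b.sum_repr' (A _), map_sum, map_smul]
      _ = A x := by rw [b.sum_repr']
  have columns : ∑ i, ∑ j, (⟪b i, A (b j)⟫_ℝ * ⟪b i, x⟫_ℝ) • b j = -A x := by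
    rw [Finset.sum_comm]
    calc ∑ j, ∑ i, (⟪b i, A (b j)⟫_ℝ * ⟪b i, x⟫_ℝ) • b j
        = ∑ j, (∑ i, ⟪x, b i⟫_ℝ * ⟪b i, A (b j)⟫_ℝ) • b j := by
          simp only [Finset.sum_smul, mul_comm, real_inner_comm x]
      _ = -∑ j, ⟪b j, A x⟫_ℝ • b j := by
          simp only [b.sum_inner_mul_inner, ← neg_eq_iff_eq_neg.2 (hA x _), neg_smul,
            Finset.sum_neg_distrib, real_inner_comm (A x)]
      _ = -A x := by rw [b.sum_repr']
  simp only [LinearMap.smul_apply, LinearMap.sum_apply, ContinuousLinearMap.coe_coe, wedge,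
    sub_apply, ContinuousLinearMap.smulRight_apply, innerSL_apply_apply,
    smul_sub, smul_smul, Finset.sum_sub_distrib, rows, columns, sub_neg_eq_add]
  exact two_smul ℝ (A x)

theorem derivationAction_PhiAlt_of_skew {A : Oct →ₗ[ℝ] Oct} (hA : ∀ x y, ⟪A x, y⟫_ℝ = -⟪x, A y⟫_ℝ) :
    (2 : ℝ) • derivationAction PhiAlt A
      = ∑ m, (∑ a, ∑ b, A (stdVec b) a * complStd m a b) • psiAlt m := by
  have h := two_smul_eq_sum_wedge (EuclideanSpace.basisFun (Fin 8) ℝ) hA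
  have hb : ∀ i, EuclideanSpace.basisFun (Fin 8) ℝ i = stdVec i := fun i => by simp [stdVec]
  simp only [hb, inner_stdVec] at h
  rw [← map_smul, h]
  simp only [map_sum, map_smul, derivationAction_wedge_stdVec, Finset.smul_sum, smul_smul,
    Finset.sum_smul]
  rw [Finset.sum_comm_cycle]

theorem derivationAction_mem_span_psiAlt {A : Oct →ₗ[ℝ] Oct}
    (hA : ∀ x y, ⟪A x, y⟫_ℝ = -⟪x, A y⟫_ℝ) :
    derivationAction PhiAlt A ∈ Submodule.span ℝ (Set.range psiAlt) := by
  rw [← Submodule.smul_mem_iff _ (two_ne_zero (α := ℝ)), derivationAction_PhiAlt_of_skew hA]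
  exact Submodule.sum_mem _ fun m _ =>
    Submodule.smul_mem _ _ (Submodule.subset_span (Set.mem_range_self m))

theorem inner_wedge_apply (u v x y : Oct) : ⟪wedge u v x, y⟫_ℝ = -⟪x, wedge u v y⟫_ℝ := by
  simp [wedge, inner_sub_left, inner_sub_right, inner_smul_left, inner_smul_right,
    real_inner_comm x]
  ring

/-! ### Invariance under `Spin(7)` -/

theorem psiAlt_compLinearMap_mem_span {g : Oct ≃ₗᵢ[ℝ] Oct}
    (hg : PhiAlt.compLinearMap g.toLinearEquiv.toLinearMap = PhiAlt) (m : Fin 7) :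
    (psiAlt m).compLinearMap g.toLinearEquiv.toLinearMap
      ∈ Submodule.span ℝ (Set.range psiAlt) := by
  obtain ⟨a, b, hm⟩ := psiAlt_eq_derivationAction m
  rw [hm, ← derivationAction_conj g.toLinearEquiv _ hg]
  refine derivationAction_mem_span_psiAlt fun x y => ?_
  have adjoint : ∀ x y, ⟪g.symm x, y⟫_ℝ = ⟪x, g y⟫_ℝ := fun x y => by
    rw [← g.inner_map_map, g.apply_symm_apply]
  have adjoint' : ∀ x y, ⟪x, g.symm y⟫_ℝ = ⟪g x, y⟫_ℝ := fun x y => by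
    rw [← g.inner_map_map, g.apply_symm_apply]
  exact (adjoint _ _).trans ((inner_wedge_apply _ _ _ _).trans (congrArg _ (adjoint' _ _).symm))

theorem psiAlt_comp_eq_of_eq {g : Oct ≃ₗᵢ[ℝ] Oct}
    (hg : PhiAlt.compLinearMap g.toLinearEquiv.toLinearMap = PhiAlt) {v w : Fin 4 → Oct}
    (h : ∀ m, psiAlt m v = psiAlt m w) (m : Fin 7) :
    psiAlt m (fun i => g (v i)) = psiAlt m (fun i => g (w i)) := by
  suffices ∀ f ∈ Submodule.span ℝ (Set.range psiAlt), f v = f w from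
    this _ (psiAlt_compLinearMap_mem_span hg m)
  intro f hf
  induction hf using Submodule.span_induction with
  | mem f hf => obtain ⟨n, rfl⟩ := hf; exact h n
  | zero => rfl
  | add f f' _ _ hf hf' => simp only [AlternatingMap.add_apply, hf, hf']
  | smul c f _ hf => simp only [AlternatingMap.smul_apply, hf]

theorem IsAdaptedFrame.exists_orthonormalBasis {F : Fin 8 → Oct} (hF : IsAdaptedFrame F) :
    ∃ b : OrthonormalBasis (Fin 8) ℝ Oct, ⇑b = F :=
  ⟨(basisOfOrthonormalOfCardEqFinrank hF.1 (by simp)).toOrthonormalBasis (by simpa using hF.1),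
    by simp⟩

theorem IsAdaptedFrame.exists_isometry {F : Fin 8 → Oct} (hF : IsAdaptedFrame F) :
    ∃ g : Oct ≃ₗᵢ[ℝ] Oct, (∀ i, g (stdVec i) = F i) ∧
      PhiAlt.compLinearMap g.toLinearEquiv.toLinearMap = PhiAlt := by
  obtain ⟨b, hb⟩ := hF.exists_orthonormalBasis
  let std := EuclideanSpace.basisFun (Fin 8) ℝ
  have hstd : ∀ i, std i = stdVec i := fun i => by simp [std, stdVec]
  have hg : ∀ i, std.equiv b (Equiv.refl _) (stdVec i) = F i := fun i => by
    rw [← hstd, OrthonormalBasis.equiv_apply_basis, Equiv.refl_apply, hb]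
  refine ⟨std.equiv b (Equiv.refl _), hg, Module.Basis.ext_alternating std.toBasis fun t _ => ?_⟩
  simp only [AlternatingMap.compLinearMap_apply, OrthonormalBasis.coe_toBasis, hstd, PhiAlt_apply,
    LinearEquiv.coe_coe, LinearIsometryEquiv.coe_toLinearEquiv, hg]
  exact hF.2 _ _ _ _

/-! ### Complex coordinates normal to a complex line -/

/-- The complex coordinates `(x³ + i x⁴, x⁶ - i x⁷, x⁵ - i x⁸)` of the part of a vector that is
normal to the plane of the first two basis vectors. -/
def complexCoord : (Fin 8 → ℝ) →L[ℝ] (Fin 3 → ℂ) :=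
  LinearMap.toContinuousLinearMap
    { toFun := fun x => ![(x 3 : ℂ) + Complex.I * (x 4 : ℂ), (x 6 : ℂ) - Complex.I * (x 7 : ℂ),
        (x 5 : ℂ) - Complex.I * (x 8 : ℂ)]
      map_add' := fun x y => by ext i; fin_cases i <;> simp <;> ring
      map_smul' := fun c x => by ext i; fin_cases i <;> simp <;> ring }

theorem complexCoord_apply (x : Fin 8 → ℝ) : complexCoord x =
    ![(x 3 : ℂ) + Complex.I * (x 4 : ℂ), (x 6 : ℂ) - Complex.I * (x 7 : ℂ),
      (x 5 : ℂ) - Complex.I * (x 8 : ℂ)] := rfl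

/-- The complex coordinates in a frame `F` of the part of a vector normal to `F₁ ∧ F₂`. -/
def normalCoord (F : Fin 8 → Oct) : Oct →L[ℝ] (Fin 3 → ℂ) :=
  complexCoord ∘L ContinuousLinearMap.pi fun a => innerSL ℝ (F a)

theorem normalCoord_apply (F : Fin 8 → Oct) (X : Oct) :
    normalCoord F X = complexCoord fun a => ⟪F a, X⟫_ℝ := rfl

theorem psi_stdVec_one_two (x y : Oct) (m : Fin 7) :
    letI c := complexCoord x ⨯₃ complexCoord y
    psi m (stdVec 1) (stdVec 2) x y
      = ![(c 2).im, (c 2).re, (c 1).re, (c 1).im, 0, -(c 0).re, (c 0).im] m := by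
  have laplace : ∀ i j k l : Fin 8, dx i j k l (stdVec 1) (stdVec 2) x y =
      (stdVec 1 i * stdVec 2 j - stdVec 1 j * stdVec 2 i) * (x k * y l - x l * y k)
      - (stdVec 1 i * stdVec 2 k - stdVec 1 k * stdVec 2 i) * (x j * y l - x l * y j)
      + (stdVec 1 i * stdVec 2 l - stdVec 1 l * stdVec 2 i) * (x j * y k - x k * y j)
      + (stdVec 1 j * stdVec 2 k - stdVec 1 k * stdVec 2 j) * (x i * y l - x l * y i)
      - (stdVec 1 j * stdVec 2 l - stdVec 1 l * stdVec 2 j) * (x i * y k - x k * y i)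
      + (stdVec 1 k * stdVec 2 l - stdVec 1 l * stdVec 2 k) * (x i * y j - x j * y i) := by
    intro i j k l
    simp only [dx, Matrix.det_succ_row_zero, Fin.sum_univ_succ]
    simp [Fin.succAbove, Matrix.submatrix]
    ring
  fin_cases m <;>
    simp [psi, laplace, stdVec_apply, complexCoord_apply, cross_apply, Fin.ext_iff] <;> ring

theorem psi_stdVec_one_two_eq_iff (x y x' y' : Oct) :
    (∀ m, psi m (stdVec 1) (stdVec 2) x y = psi m (stdVec 1) (stdVec 2) x' y')
      ↔ complexCoord x ⨯₃ complexCoord y = complexCoord x' ⨯₃ complexCoord y' := by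
  simp only [psi_stdVec_one_two]
  refine ⟨fun h => ?_, fun h m => by rw [h]⟩
  ext i
  fin_cases i
  · exact Complex.ext (neg_injective (h 5)) (h 6)
  · exact Complex.ext (h 2) (h 3)
  · exact Complex.ext (h 1) (h 0)

theorem IsAdaptedFrame.psi_eq_iff {F : Fin 8 → Oct} (hF : IsAdaptedFrame F) (X Y X' Y' : Oct) :
    (∀ m, psi m (F 1) (F 2) X Y = psi m (F 1) (F 2) X' Y')
      ↔ normalCoord F X ⨯₃ normalCoord F Y = normalCoord F X' ⨯₃ normalCoord F Y' := by
  obtain ⟨g, hgF, hg⟩ := hF.exists_isometry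
  have hgsymm : PhiAlt.compLinearMap g.symm.toLinearEquiv.toLinearMap = PhiAlt := by
    ext v
    nth_rw 1 [← hg]
    simp [AlternatingMap.compLinearMap_apply]
  have hcoord : ∀ X, normalCoord F X = complexCoord (g.symm X) := fun X => by
    rw [normalCoord_apply]
    congr 1
    ext a
    rw [← inner_stdVec, ← hgF, ← g.inner_map_map (stdVec a), g.apply_symm_apply]
  simp only [hcoord, ← psi_stdVec_one_two_eq_iff]
  constructor
  · intro h
    simpa [psiAlt_apply, ← hgF] using psiAlt_comp_eq_of_eq hgsymm (v := ![F 1, F 2, X, Y])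
      (w := ![F 1, F 2, X', Y']) fun m => by simpa [psiAlt_apply] using h m
  · intro h
    simpa [psiAlt_apply, hgF] using psiAlt_comp_eq_of_eq hg
      (v := ![stdVec 1, stdVec 2, g.symm X, g.symm Y])
      (w := ![stdVec 1, stdVec 2, g.symm X', g.symm Y']) fun m => by
        simpa [psiAlt_apply] using h m

theorem IsAdaptedFrame.psi_eq_zero_iff {F : Fin 8 → Oct} (hF : IsAdaptedFrame F) (X Y : Oct) :
    (∀ m, psi m (F 1) (F 2) X Y = 0) ↔ normalCoord F X ⨯₃ normalCoord F Y = 0 := by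
  have h := hF.psi_eq_iff X Y 0 0
  have h0 : ∀ m, psi m (F 1) (F 2) 0 0 = 0 := fun m => by
    simpa [psiAlt_apply] using (psiAlt m).map_coord_zero (m := ![F 1, F 2, 0, 0]) 2 rfl
  simpa only [h0, map_zero, LinearMap.zero_apply] using h

/-! ### Moving frames -/

section MovingFrame

variable {ι E G : Type*} [NormedAddCommGroup E] [NormedAddCommGroup G] [NormedSpace ℝ G]

theorem inner_deriv_eq_neg_of_orthonormal [InnerProductSpace ℝ E] {F : ℝ → ι → E} {F' : ι → E}
    {t : ℝ} (hF : ∀ᶠ s in 𝓝 t, Orthonormal ℝ (F s))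
    (hd : ∀ i, HasDerivAt (fun s => F s i) (F' i) t) (a b : ι) :
    ⟪F t b, F' a⟫_ℝ = -⟪F t a, F' b⟫_ℝ := by
  classical
  have hconst : HasDerivAt (fun s => ⟪F s a, F s b⟫_ℝ) 0 t := by
    refine (hasDerivAt_const t (if a = b then (1 : ℝ) else 0)).congr_of_eventuallyEq ?_
    filter_upwards [hF] with s hs
    exact orthonormal_iff_ite.1 hs a b
  have := ((hd a).inner ℝ (hd b)).unique hconst
  rw [real_inner_comm (F' a)]
  linarith

theorem hasDerivAt_alternatingMap [NormedSpace ℝ E] [Fintype ι] [DecidableEq ι]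
    {f : E [⋀^ι]→ₗ[ℝ] G} (hf : Continuous f) {x : ℝ → ι → E} {x' : ι → E} {t : ℝ}
    (h : ∀ i, HasDerivAt (fun s => x s i) (x' i) t) :
    HasDerivAt (fun s => f (x s)) (∑ i, f (Function.update (x t) i (x' i))) t := by
  let F : ContinuousMultilinearMap ℝ (fun _ : ι => E) G := ⟨f.toMultilinearMap, hf⟩
  refine (HasFDerivAt.multilinear_comp F fun i => (h i).hasFDerivAt).hasDerivAt.congr_deriv ?_
  rw [sum_apply]
  simp only [ContinuousLinearMap.comp_apply,
    ContinuousLinearMap.toSpanSingleton_apply, one_smul]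
  rfl

end MovingFrame

theorem continuous_PhiAlt : Continuous PhiAlt := by
  have h : ∀ i j k l, Continuous (dxAlt i j k l) := by
    intro i j k l
    change Continuous fun v : Fin 4 → Oct => Matrix.det (Matrix.of fun a b => v a (![i, j, k, l] b))
    refine Continuous.matrix_det (continuous_matrix fun a b => ?_)
    exact (EuclideanSpace.proj (𝕜 := ℝ) (![i, j, k, l] b)).continuous.comp (continuous_apply a)
  change Continuous fun v => PhiAlt v
  simp only [PhiAlt, cayleySum, AlternatingMap.sub_apply, AlternatingMap.add_apply]
  fun_prop (disch := assumption)

/-- The Lie algebra `𝔰𝔭𝔦𝔫(7)` of the stabilizer of `Φ` in the orthogonal group, as a set of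
matrices. -/
def IsSpin7 (w : Matrix (Fin 8) (Fin 8) ℝ) : Prop :=
  wᵀ = -w ∧ derivationAction PhiAlt w.toEuclideanLin = 0

/-- The matrix `ω_{ab} = ⟨F_a, F_b'⟩` that expresses the velocity `F'` of a moving frame `F` in
the frame itself. -/
def frameVelocity (F F' : Fin 8 → Oct) : Matrix (Fin 8) (Fin 8) ℝ :=
  Matrix.of fun a b => ⟪F a, F' b⟫_ℝ

theorem IsAdaptedFrame.sum_inner_smul {F : Fin 8 → Oct} (hF : IsAdaptedFrame F) (x : Oct) :
    ∑ a, ⟪F a, x⟫_ℝ • F a = x := by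
  obtain ⟨b, rfl⟩ := hF.exists_orthonormalBasis
  exact b.sum_repr' x

theorem isSpin7_frameVelocity {F : ℝ → Fin 8 → Oct} {F' : Fin 8 → Oct} {t : ℝ}
    (hF : ∀ᶠ s in 𝓝 t, IsAdaptedFrame (F s))
    (hd : ∀ i, HasDerivAt (fun s => F s i) (F' i) t) : IsSpin7 (frameVelocity (F t) F') := by
  refine ⟨Matrix.ext (inner_deriv_eq_neg_of_orthonormal (hF.mono fun _ h => h.1) hd),
    Module.Basis.ext_alternating (EuclideanSpace.basisFun (Fin 8) ℝ).toBasis fun c _ => ?_⟩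
  have hFt : IsAdaptedFrame (F t) := hF.self_of_nhds
  obtain ⟨g, hgF, hg⟩ := hFt.exists_isometry
  have hvel : ∀ b, g ((frameVelocity (F t) F').toEuclideanLin (stdVec b)) = F' b := fun b => by
    have hcol : (frameVelocity (F t) F').toEuclideanLin (stdVec b)
        = ∑ a, ⟪F t a, F' b⟫_ℝ • stdVec a := by
      ext a
      trans ⟪F t a, F' b⟫_ℝ
      · simp [frameVelocity, stdVec]
      · simp [stdVec_apply]
    simp only [hcol, map_sum, map_smul, hgF, hFt.sum_inner_smul]
  have hconst : HasDerivAt (fun s => PhiAlt fun i => F s (c i)) 0 t := by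
    refine (hasDerivAt_const t (PhiAlt fun i => stdVec (c i))).congr_of_eventuallyEq ?_
    filter_upwards [hF] with s hs
    simpa only [PhiAlt_apply] using hs.2 _ _ _ _
  have hleibniz := (hasDerivAt_alternatingMap continuous_PhiAlt fun i => hd (c i)).unique hconst
  rw [derivationAction_apply, AlternatingMap.zero_apply, ← hleibniz]
  refine Finset.sum_congr rfl fun i _ => ?_
  nth_rw 1 [← hg]
  refine congrArg PhiAlt (funext fun j => ?_)
  have hstd : ∀ b, (EuclideanSpace.basisFun (Fin 8) ℝ).toBasis b = stdVec b := by simp [stdVec]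
  rcases eq_or_ne j i with rfl | h
  · simp [hstd, hvel]
  · simp [hstd, h, hgF]

theorem IsSpin7.sum_mul_complStd {w : Matrix (Fin 8) (Fin 8) ℝ} (hw : IsSpin7 w) (m : Fin 7) :
    ∑ a, ∑ b, w a b * complStd m a b = 0 := by
  have hskew : ∀ x y, ⟪w.toEuclideanLin x, y⟫_ℝ = -⟪x, w.toEuclideanLin y⟫_ℝ := fun x y => by
    have hadj : w.toEuclideanLin.adjoint = -w.toEuclideanLin := by
      rw [← Matrix.toEuclideanLin_conjTranspose_eq_adjoint,
        Matrix.conjTranspose_eq_transpose_of_trivial, hw.1, map_neg]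
    simpa only [hadj, LinearMap.neg_apply, inner_neg_right]
      using (w.toEuclideanLin.adjoint_inner_right x y).symm
  have h : ∑ m, (∑ a, ∑ b, w.toEuclideanLin (stdVec b) a * complStd m a b) • psiAlt m = 0 :=
    (derivationAction_PhiAlt_of_skew hskew).symm.trans (by rw [hw.2, smul_zero])
  have hentry : ∀ a b, w.toEuclideanLin (stdVec b) a = w a b := fun a b => by simp [stdVec]
  simpa only [hentry] using Fintype.linearIndependent_iff.1 linearIndependent_psiAlt _ h m

theorem IsSpin7.swap {w : Matrix (Fin 8) (Fin 8) ℝ} (hw : IsSpin7 w) (a b : Fin 8) :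
    w b a = -w a b := congr_fun₂ hw.1 a b

theorem IsSpin7.relations {w : Matrix (Fin 8) (Fin 8) ℝ} (hw : IsSpin7 w) :
    w 8 1 = w 5 2 + w 6 3 + w 7 4 ∧ w 8 2 = -w 5 1 + w 7 3 - w 6 4 ∧
    w 8 3 = -w 6 1 - w 7 2 + w 5 4 ∧ w 8 4 = -w 7 1 + w 6 2 - w 5 3 ∧
    w 8 5 = w 2 1 + w 4 3 - w 7 6 ∧ w 8 6 = w 3 1 - w 4 2 + w 7 5 ∧
    w 8 7 = w 4 1 + w 3 2 - w 6 5 := by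
  have hsum : ∀ k l, ∑ a, ∑ b, w a b * (dxTwoStd k l a b : ℝ) = -2 * w l k := fun k l => by
    have hpick : ∀ a b, (dxTwoStd k l a b : ℝ)
        = (if k = a then 1 else 0) * (if l = b then 1 else 0)
          - (if k = b then 1 else 0) * (if l = a then 1 else 0) := fun a b => by
      simp only [dxTwoStd, Int.cast_sub, pick_cast, stdVec_apply, Int.cast_one, mul_one]
    simp [hpick, mul_sub, Finset.sum_sub_distrib, hw.swap l k]
    ring
  have h := hw.sum_mul_complStd
  have h0 := h 0; have h1 := h 1; have h2 := h 2; have h3 := h 3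
  have h4 := h 4; have h5 := h 5; have h6 := h 6
  simp only [complStd, Matrix.cons_val, Int.cast_add, Int.cast_sub, Int.cast_neg, mul_add, mul_sub,
    mul_neg, Finset.sum_add_distrib, Finset.sum_sub_distrib, Finset.sum_neg_distrib, hsum]
    at h0 h1 h2 h3 h4 h5 h6
  refine ⟨?_, ?_, ?_, ?_, ?_, ?_, ?_⟩ <;> linarith

/-! ### The action of `𝔰𝔭𝔦𝔫(7)` in complex coordinates -/

/-- The values of `θ₁`, `θ₃`, `θ₅` on a tangent vector, in terms of the value `w` of the
connection matrix. -/
def thetaVec (w : Matrix (Fin 8) (Fin 8) ℝ) : Fin 3 → ℂ :=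
  complexCoord (wᵀ 1) + Complex.I • complexCoord (wᵀ 2)

/-- The value of `κ` on a tangent vector, in terms of the value `w` of the connection matrix. -/
def kappaMat (w : Matrix (Fin 8) (Fin 8) ℝ) : Matrix (Fin 3) (Fin 3) ℂ :=
  !![Complex.I * w 4 3,
     -(w 6 3 + Complex.I * w 6 4) - (Complex.I / 2) * starRingEnd ℂ (thetaVec w 2),
     -(w 5 3 + Complex.I * w 5 4) + (Complex.I / 2) * starRingEnd ℂ (thetaVec w 1);
     (w 6 3 - Complex.I * w 6 4) - (Complex.I / 2) * thetaVec w 2,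
     -(Complex.I * w 7 6),
     (w 6 5 - Complex.I * w 7 5) - (Complex.I / 2) * starRingEnd ℂ (thetaVec w 0);
     (w 5 3 - Complex.I * w 5 4) + (Complex.I / 2) * thetaVec w 1,
     -(w 6 5 + Complex.I * w 7 5) - (Complex.I / 2) * thetaVec w 0,
     Complex.I * (w 7 6 - w 4 3 - w 2 1)]

theorem IsSpin7.complexCoord_mulVec {w : Matrix (Fin 8) (Fin 8) ℝ} (hw : IsSpin7 w)
    (x : Fin 8 → ℝ) :
    complexCoord (w *ᵥ x) = x 1 • complexCoord (wᵀ 1) + x 2 • complexCoord (wᵀ 2)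
      + kappaMat w *ᵥ complexCoord x
      + (Complex.I / 2) • (star (complexCoord x) ⨯₃ star (thetaVec w)) := by
  obtain ⟨r1, r2, r3, r4, r5, r6, r7⟩ := hw.relations
  have diag : ∀ a, w a a = 0 := fun a => by have := hw.swap a a; linarith
  have upper := fun a b => hw.swap b a
  simp only [show (8 : Fin 8) = 0 from rfl] at r1 r2 r3 r4 r5 r6 r7
  have row : ∀ a, (w *ᵥ x) a = ∑ b, w a b * x b := fun a => rfl
  have row' : ∀ i, (kappaMat w *ᵥ complexCoord x) i = ∑ j, kappaMat w i j * complexCoord x j :=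
    fun i => rfl
  ext i
  rw [Pi.add_apply, Pi.add_apply, row']
  fin_cases i <;>
  · simp [cross_apply, kappaMat, thetaVec, complexCoord_apply, row, Fin.sum_univ_eight,
      Fin.sum_univ_three, diag, upper 3 4, upper 3 5, upper 3 6, upper 3 7, upper 3 0, upper 4 5,
      upper 4 6, upper 4 7, upper 4 0, upper 5 6, upper 5 7, upper 5 0, upper 6 7, upper 6 0,
      upper 7 0, r1, r2, r3, r4, r5, r6, r7, Complex.ext_iff]
    constructor <;> ring

/-! ### Normal coordinates along a moving frame -/

theorem hasDerivAt_inner_frame {F : ℝ → Fin 8 → Oct} {F' : Fin 8 → Oct} {X : ℝ → Oct} {X' : Oct}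
    {t : ℝ} (hF : ∀ᶠ s in 𝓝 t, IsAdaptedFrame (F s))
    (hd : ∀ i, HasDerivAt (fun s => F s i) (F' i) t) (hX : HasDerivAt X X' t) (a : Fin 8) :
    HasDerivAt (fun s => ⟪F s a, X s⟫_ℝ)
      (⟪F t a, X'⟫_ℝ - (frameVelocity (F t) F' *ᵥ fun b => ⟪F t b, X t⟫_ℝ) a) t := by
  refine ((hd a).inner ℝ hX).congr_deriv ?_
  have hskew := (isSpin7_frameVelocity hF hd).swap
  have hF' : ⟪F' a, X t⟫_ℝ = -∑ b, frameVelocity (F t) F' a b * ⟪F t b, X t⟫_ℝ := by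
    nth_rw 1 [← hF.self_of_nhds.sum_inner_smul (X t)]
    rw [inner_sum, ← Finset.sum_neg_distrib]
    refine Finset.sum_congr rfl fun b _ => ?_
    rw [inner_smul_right, real_inner_comm (F t b) (F' a), mul_comm, ← neg_mul, ← hskew a b]
    rfl
  rw [hF']
  rfl

theorem hasDerivAt_normalCoord {F : ℝ → Fin 8 → Oct} {F' : Fin 8 → Oct} {X : ℝ → Oct} {X' : Oct}
    {t : ℝ} (hF : ∀ᶠ s in 𝓝 t, IsAdaptedFrame (F s))
    (hd : ∀ i, HasDerivAt (fun s => F s i) (F' i) t) (hX : HasDerivAt X X' t) :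
    HasDerivAt (fun s => normalCoord (F s) (X s))
      (normalCoord (F t) X'
        - complexCoord (frameVelocity (F t) F' *ᵥ fun b => ⟪F t b, X t⟫_ℝ)) t := by
  refine (complexCoord.hasFDerivAt.comp_hasDerivAt t
    (hasDerivAt_pi.2 (hasDerivAt_inner_frame hF hd hX))).congr_deriv ?_
  exact map_sub complexCoord (fun a => ⟪F t a, X'⟫_ℝ) _

theorem normalCoord_deriv_eq {F : ℝ → Fin 8 → Oct} {F' : Fin 8 → Oct} {X : ℝ → Oct} {X' : Oct}
    {t : ℝ} (hF : ∀ᶠ s in 𝓝 t, IsAdaptedFrame (F s))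
    (hd : ∀ i, HasDerivAt (fun s => F s i) (F' i) t) (hX : HasDerivAt X X' t) {Z' : Fin 3 → ℂ}
    (hZ : HasDerivAt (fun s => normalCoord (F s) (X s)) Z' t) :
    normalCoord (F t) X' = Z' + (⟪F t 1, X t⟫_ℝ • normalCoord (F t) (F' 1)
      + ⟪F t 2, X t⟫_ℝ • normalCoord (F t) (F' 2)
      + kappaMat (frameVelocity (F t) F') *ᵥ normalCoord (F t) (X t)
      + (Complex.I / 2) •
        (star (normalCoord (F t) (X t)) ⨯₃ star (thetaVec (frameVelocity (F t) F')))) := by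
  rw [hZ.unique (hasDerivAt_normalCoord hF hd hX),
    (isSpin7_frameVelocity hF hd).complexCoord_mulVec]
  exact (sub_add_cancel _ _).symm

/-- The vector normal to `F₁ ∧ F₂` with given complex coordinates. -/
def ofNormalCoord (F : Fin 8 → Oct) (z : Fin 3 → ℂ) : Oct :=
  (z 0).re • F 3 + (z 0).im • F 4 + (z 1).re • F 6 - (z 1).im • F 7 + (z 2).re • F 5
    - (z 2).im • F 8

theorem ofNormalCoord_smul (F : Fin 8 → Oct) (c : ℂ) (z : Fin 3 → ℂ) :
    ofNormalCoord F (c • z)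
      = c.re • ofNormalCoord F z + c.im • ofNormalCoord F (Complex.I • z) := by
  simp only [ofNormalCoord, Pi.smul_apply, smul_eq_mul, Complex.mul_re, Complex.mul_im,
    Complex.I_re, Complex.I_im]
  module

section AdaptedFrame

variable {F : Fin 8 → Oct} (hF : IsAdaptedFrame F)
include hF

theorem IsAdaptedFrame.inner_eq_ite (a b : Fin 8) : ⟪F a, F b⟫_ℝ = if a = b then 1 else 0 :=
  orthonormal_iff_ite.1 hF.1 a b

theorem IsAdaptedFrame.eq_add_ofNormalCoord (X : Oct) :
    X = ⟪F 1, X⟫_ℝ • F 1 + ⟪F 2, X⟫_ℝ • F 2 + ofNormalCoord F (normalCoord F X) := by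
  nth_rw 1 [← hF.sum_inner_smul X]
  simp only [Fin.sum_univ_eight, ofNormalCoord, normalCoord_apply, complexCoord_apply]
  simp only [Fin.isValue, Matrix.cons_val, Matrix.cons_val_zero, Matrix.cons_val_one,
    Complex.add_re, Complex.add_im, Complex.sub_re, Complex.sub_im, Complex.mul_re, Complex.mul_im,
    Complex.ofReal_re, Complex.ofReal_im, Complex.I_re, Complex.I_im, zero_mul, one_mul, mul_zero,
    sub_self, add_zero, zero_add, sub_zero, zero_sub, neg_smul, sub_neg_eq_add]
  abel

theorem IsAdaptedFrame.normalCoord_ofNormalCoord (z : Fin 3 → ℂ) :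
    normalCoord F (ofNormalCoord F z) = z := by
  ext i
  fin_cases i <;> simp [normalCoord_apply, complexCoord_apply, ofNormalCoord, inner_add_right,
    inner_sub_right, inner_smul_right, hF.inner_eq_ite, Complex.ext_iff]

theorem IsAdaptedFrame.inner_ofNormalCoord (z z' : Fin 3 → ℂ) :
    ⟪ofNormalCoord F z, ofNormalCoord F z'⟫_ℝ = (star z ⬝ᵥ z').re := by
  simp [ofNormalCoord, inner_add_right, inner_sub_right, inner_add_left, inner_sub_left,
    inner_smul_right, inner_smul_left, hF.inner_eq_ite, hF.1.1, dotProduct, Fin.sum_univ_three]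
  ring

theorem IsAdaptedFrame.inner_one_ofNormalCoord (z : Fin 3 → ℂ) :
    ⟪F 1, ofNormalCoord F z⟫_ℝ = 0 := by
  simp [ofNormalCoord, inner_add_right, inner_sub_right, inner_smul_right, hF.inner_eq_ite]

theorem IsAdaptedFrame.inner_two_ofNormalCoord (z : Fin 3 → ℂ) :
    ⟪F 2, ofNormalCoord F z⟫_ℝ = 0 := by
  simp [ofNormalCoord, inner_add_right, inner_sub_right, inner_smul_right, hF.inner_eq_ite]

end AdaptedFrame

/-! ### Parallel families of subspaces -/

section Parallel

variable {ι E D : Type*} [NormedAddCommGroup E] [InnerProductSpace ℝ E]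
  [NormedAddCommGroup D] [NormedSpace ℝ D]

theorem inner_fderiv_eq_neg_of_orthonormal {f : D → ι → E} {q : D}
    (ho : ∀ᶠ p in 𝓝 q, Orthonormal ℝ (f p)) (hf : ∀ i, DifferentiableAt ℝ (fun p => f p i) q)
    (u : D) (i j : ι) :
    ⟪f q j, fderiv ℝ (fun p => f p i) q u⟫_ℝ = -⟪f q i, fderiv ℝ (fun p => f p j) q u⟫_ℝ := by
  have hline : Tendsto (fun t : ℝ => q + t • u) (𝓝 0) (𝓝 q) :=
    Continuous.tendsto' (by fun_prop) _ _ (by simp)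
  simpa only [zero_smul, add_zero] using inner_deriv_eq_neg_of_orthonormal
    (F := fun t i => f (q + t • u) i) (hline.eventually ho)
    (fun i => (hf i).hasFDerivAt.hasLineDerivAt u) i j

theorem sum_inner_mul_inner_eq_zero_of_skew [Fintype ι] {v v' : ι → E} (hv : Orthonormal ℝ v)
    (hmem : ∀ i, v' i ∈ Submodule.span ℝ (Set.range v))
    (hskew : ∀ i j, ⟪v j, v' i⟫_ℝ = -⟪v i, v' j⟫_ℝ) (w : E) :
    ∑ i, ⟪v i, w⟫_ℝ * ⟪v' i, w⟫_ℝ = 0 := by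
  have hexpand : ∀ i, v' i = ∑ j, ⟪v j, v' i⟫_ℝ • v j := fun i => by
    obtain ⟨c, hc⟩ := (Submodule.mem_span_range_iff_exists_fun ℝ).1 (hmem i)
    simp only [← hc, hv.inner_right_fintype]
  have hsum : ∑ i, ⟪v i, w⟫_ℝ * ⟪v' i, w⟫_ℝ
      = ∑ i, ∑ j, ⟪v j, v' i⟫_ℝ * (⟪v i, w⟫_ℝ * ⟪v j, w⟫_ℝ) := by
    refine Finset.sum_congr rfl fun i _ => ?_
    nth_rw 1 [hexpand i]
    rw [sum_inner, Finset.mul_sum]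
    exact Finset.sum_congr rfl fun j _ => by rw [real_inner_smul_left, mul_left_comm]
  have hneg : ∑ i, ∑ j, ⟪v j, v' i⟫_ℝ * (⟪v i, w⟫_ℝ * ⟪v j, w⟫_ℝ)
      = -∑ i, ∑ j, ⟪v j, v' i⟫_ℝ * (⟪v i, w⟫_ℝ * ⟪v j, w⟫_ℝ) := by
    nth_rw 1 [Finset.sum_comm]
    simp only [← Finset.sum_neg_distrib]
    exact Finset.sum_congr rfl fun i _ => Finset.sum_congr rfl fun j _ => by
      rw [hskew, neg_mul, mul_comm ⟪v j, w⟫_ℝ]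
  linarith

/-- If `w` is orthogonal to the span at one point, then the squared length of its projection to the
span has zero derivative. -/
theorem mem_span_of_fderiv_mem_span [Finite ι] {f : D → ι → E} {Ω : Set D} (hΩ : IsOpen Ω)
    (hconn : IsPreconnected Ω) (hf : ∀ i, ∀ q ∈ Ω, DifferentiableAt ℝ (fun p => f p i) q)
    (ho : ∀ q ∈ Ω, Orthonormal ℝ (f q))
    (hD : ∀ q ∈ Ω, ∀ u i, fderiv ℝ (fun p => f p i) q u ∈ Submodule.span ℝ (Set.range (f q)))
    {q₀ q : D} (hq₀ : q₀ ∈ Ω) (hq : q ∈ Ω) (i : ι) :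
    f q i ∈ Submodule.span ℝ (Set.range (f q₀)) := by
  have := Fintype.ofFinite ι
  have hfin := FiniteDimensional.span_of_finite ℝ (Set.finite_range (f q₀))
  rw [← Submodule.orthogonal_orthogonal (Submodule.span ℝ (Set.range (f q₀)))]
  refine (Submodule.mem_orthogonal' _ _).2 fun w hw => ?_
  have hcoef : ∀ j, ∀ p ∈ Ω, HasFDerivAt (fun p => ⟪f p j, w⟫_ℝ ^ 2) _ p := fun j p hp =>
    (((hf j p hp).hasFDerivAt.inner ℝ (hasFDerivAt_const w p)).pow 2)
  have hφ : ∀ p ∈ Ω, HasFDerivAt (fun p => ∑ j, ⟪f p j, w⟫_ℝ ^ 2) (0 : D →L[ℝ] ℝ) p := by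
    refine fun p hp => (HasFDerivAt.fun_sum fun j _ => hcoef j p hp).congr_fderiv ?_
    ext u
    have hzero := sum_inner_mul_inner_eq_zero_of_skew (ho p hp) (hD p hp u)
      (inner_fderiv_eq_neg_of_orthonormal (eventually_of_mem (hΩ.mem_nhds hp) ho)
        (fun i => hf i p hp) u) w
    simp [sum_apply, mul_assoc, ← Finset.mul_sum, hzero]
  have hconst := hΩ.is_const_of_fderiv_eq_zero hconn
    (fun p hp => (hφ p hp).differentiableAt.differentiableWithinAt) (fun p hp => (hφ p hp).fderiv)
    hq hq₀
  have hq₀w : ∀ j, ⟪f q₀ j, w⟫_ℝ = 0 := fun j =>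
    (Submodule.mem_orthogonal _ _).1 hw _ (Submodule.subset_span ⟨j, rfl⟩)
  simp only [hq₀w, ne_eq, OfNat.ofNat_ne_zero, not_false_eq_true, zero_pow, Finset.sum_const_zero,
    Finset.sum_eq_zero_iff_of_nonneg fun _ _ => sq_nonneg _] at hconst
  simpa using hconst i (Finset.mem_univ i)

end Parallel

/-! ### The normal part of the derivative -/

section SecondDerivative

variable {D W : Type*} [NormedAddCommGroup D] [NormedSpace ℝ D] [NormedAddCommGroup W]
  [NormedSpace ℝ W] {f : D → W} {q : D} (hf : ContDiffAt ℝ 2 f q)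
include hf

theorem differentiableAt_fderiv_apply (v : D) : DifferentiableAt ℝ (fun p => fderiv ℝ f p v) q :=
  ((hf.fderiv_right (m := 1) (by norm_num)).differentiableAt one_ne_zero).clm_apply
    (differentiableAt_const v)

theorem fderiv_fderiv_apply_comm (u v : D) :
    fderiv ℝ (fun p => fderiv ℝ f p u) q v = fderiv ℝ (fun p => fderiv ℝ f p v) q u := by
  have hd : DifferentiableAt ℝ (fderiv ℝ f) q :=
    (hf.fderiv_right (m := 1) (by norm_num)).differentiableAt one_ne_zero
  have happly : ∀ a c, fderiv ℝ (fun p => fderiv ℝ f p a) q c = fderiv ℝ (fderiv ℝ f) q c a :=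
    fun a c => by simp [fderiv_clm_apply hd (differentiableAt_const a)]
  rw [happly, happly]
  exact hf.isSymmSndFDerivAt (by simp) v u

end SecondDerivative

theorem mem_span_singleton_of_cross_eq_zero {K : Type*} [Field K] {b z : Fin 3 → K} (hb : b ≠ 0)
    (h : z ⨯₃ b = 0) : z ∈ K ∙ b := by
  have hdep : ¬LinearIndependent K ![b, z] := fun hli =>
    crossProduct_ne_zero_iff_linearIndependent.2 hli (by rw [← cross_anticomm, h, neg_zero])
  simpa [LinearIndependent.pair_iff' hb, Submodule.mem_span_singleton] using hdep

theorem eq_dotProduct_smul_of_mem_span {n : Type*} [Fintype n] {b z : n → ℂ}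
    (hb : star b ⬝ᵥ b = 1) (hz : z ∈ ℂ ∙ b) : z = (star b ⬝ᵥ z) • b := by
  obtain ⟨c, rfl⟩ := Submodule.mem_span_singleton.1 hz
  rw [dotProduct_smul, hb, smul_eq_mul, mul_one]

theorem differentiableAt_normalCoord {D : Type*} [NormedAddCommGroup D] [NormedSpace ℝ D]
    {e : D → Fin 8 → Oct} {X : D → Oct} {q : D} (he : ∀ i, DifferentiableAt ℝ (fun p => e p i) q)
    (hX : DifferentiableAt ℝ X q) : DifferentiableAt ℝ (fun p => normalCoord (e p) (X p)) q :=
  complexCoord.differentiableAt.comp q (differentiableAt_pi.2 fun a => (he a).inner ℝ hX)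

/-- The covariant derivative `∇b = db + κ b` of a family of normal coordinates. -/
def covDeriv {D : Type*} [NormedAddCommGroup D] [NormedSpace ℝ D] (e : D → Fin 8 → Oct)
    (b : D → Fin 3 → ℂ) (q u : D) : Fin 3 → ℂ :=
  fderiv ℝ b q u
    + kappaMat (frameVelocity (e q) fun i => fderiv ℝ (fun p => e p i) q u) *ᵥ b q

section NormalDirection

variable {D : Type*} [NormedAddCommGroup D] [NormedSpace ℝ D] {e : D → Fin 8 → Oct}
  {b : D → Fin 3 → ℂ} {q u v : D}

theorem normalCoord_fderiv_eq (he : ∀ i, DifferentiableAt ℝ (fun p => e p i) q)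
    (ha : ∀ᶠ p in 𝓝 q, IsAdaptedFrame (e p)) {X : D → Oct} (hX : DifferentiableAt ℝ X q) (u : D) :
    normalCoord (e q) (fderiv ℝ X q u) = fderiv ℝ (fun p => normalCoord (e p) (X p)) q u
      + (⟪e q 1, X q⟫_ℝ • normalCoord (e q) (fderiv ℝ (fun p => e p 1) q u)
        + ⟪e q 2, X q⟫_ℝ • normalCoord (e q) (fderiv ℝ (fun p => e p 2) q u)
        + kappaMat (frameVelocity (e q) fun i => fderiv ℝ (fun p => e p i) q u)
          *ᵥ normalCoord (e q) (X q)
        + (Complex.I / 2) • (star (normalCoord (e q) (X q))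
          ⨯₃ star (thetaVec (frameVelocity (e q) fun i => fderiv ℝ (fun p => e p i) q u)))) := by
  have hline : Tendsto (fun t : ℝ => q + t • u) (𝓝 0) (𝓝 q) :=
    Continuous.tendsto' (by fun_prop) _ _ (by simp)
  simpa only [zero_smul, add_zero] using normalCoord_deriv_eq (F := fun t : ℝ => e (q + t • u))
    (hline.eventually ha) (fun i => (he i).hasFDerivAt.hasLineDerivAt u)
    (hX.hasFDerivAt.hasLineDerivAt u)
    ((differentiableAt_normalCoord he hX).hasFDerivAt.hasLineDerivAt u)

/-- The conjugate-linear term `c̄ b̄ × θ̄` of the covariant derivative vanishes because `θ` is a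
multiple of `b`. -/
theorem normalCoord_fderiv_sub_mem_span (he : ∀ i, DifferentiableAt ℝ (fun p => e p i) q)
    (ha : ∀ᶠ p in 𝓝 q, IsAdaptedFrame (e p)) (hb : DifferentiableAt ℝ b q)
    (hunit : ∀ᶠ p in 𝓝 q, star (b p) ⬝ᵥ b p = 1)
    (hde : ∀ k ∈ ({1, 2} : Finset (Fin 8)),
      normalCoord (e q) (fderiv ℝ (fun p => e p k) q u) ∈ ℂ ∙ b q)
    {X : D → Oct} (hX : DifferentiableAt ℝ X q)
    (hXb : ∀ᶠ p in 𝓝 q, normalCoord (e p) (X p) ∈ ℂ ∙ b p) :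
    normalCoord (e q) (fderiv ℝ X q u)
      - (star (b q) ⬝ᵥ normalCoord (e q) (X q)) • covDeriv e b q u ∈ ℂ ∙ b q := by
  set c : D → ℂ := fun p => star (b p) ⬝ᵥ normalCoord (e p) (X p)
  have hev : (fun p => normalCoord (e p) (X p)) =ᶠ[𝓝 q] fun p => c p • b p :=
    (hunit.and hXb).mono fun p hp => eq_dotProduct_smul_of_mem_span hp.1 hp.2
  have hc : DifferentiableAt ℝ c q := by
    have hz := differentiableAt_pi.1 (differentiableAt_normalCoord he hX)
    have hbi := differentiableAt_pi.1 hb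
    simp only [c, dotProduct, Pi.star_apply]
    fun_prop
  have hfderiv : fderiv ℝ (fun p => normalCoord (e p) (X p)) q u
      = c q • fderiv ℝ b q u + fderiv ℝ c q u • b q := by
    rw [hev.fderiv_eq, fderiv_fun_smul hc hb]
    rfl
  obtain ⟨τ₁, h1⟩ := Submodule.mem_span_singleton.1 (hde 1 (by decide))
  obtain ⟨τ₂, h2⟩ := Submodule.mem_span_singleton.1 (hde 2 (by decide))
  have hcov := normalCoord_fderiv_eq he ha hX u
  set w := frameVelocity (e q) fun i => fderiv ℝ (fun p => e p i) q u
  have hθ : thetaVec w = (τ₁ + Complex.I * τ₂) • b q := by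
    rw [add_smul, mul_smul, h1, h2]
    rfl
  have hcross : star (c q • b q) ⨯₃ star (thetaVec w) = 0 := by
    rw [hθ, star_smul, star_smul, map_smul, LinearMap.map_smul₂, cross_self, smul_zero, smul_zero]
  change _ - c q • covDeriv e b q u ∈ _
  rw [hcov, hfderiv, hev.eq_of_nhds, hcross, ← h1, ← h2, Matrix.mulVec_smul, covDeriv]
  refine Submodule.mem_span_singleton.2 ⟨fderiv ℝ c q u + ⟪e q 1, X q⟫_ℝ * τ₁
    + ⟪e q 2, X q⟫_ℝ * τ₂, ?_⟩
  simp only [← Complex.coe_smul]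
  module

theorem smul_covDeriv_sub_smul_covDeriv_mem_span
    (he : ∀ i, DifferentiableAt ℝ (fun p => e p i) q)
    (ha : ∀ᶠ p in 𝓝 q, IsAdaptedFrame (e p)) (hb : DifferentiableAt ℝ b q)
    (hunit : ∀ᶠ p in 𝓝 q, star (b p) ⬝ᵥ b p = 1)
    (hde : ∀ u, ∀ k ∈ ({1, 2} : Finset (Fin 8)),
      normalCoord (e q) (fderiv ℝ (fun p => e p k) q u) ∈ ℂ ∙ b q)
    {f : D → Oct} (hf : ContDiffAt ℝ 2 f q)
    (hfb : ∀ᶠ p in 𝓝 q, ∀ u, normalCoord (e p) (fderiv ℝ f p u) ∈ ℂ ∙ b p) (u v : D) :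
    (star (b q) ⬝ᵥ normalCoord (e q) (fderiv ℝ f q v)) • covDeriv e b q u
      - (star (b q) ⬝ᵥ normalCoord (e q) (fderiv ℝ f q u)) • covDeriv e b q v ∈ ℂ ∙ b q := by
  have hcov := fun u v => normalCoord_fderiv_sub_mem_span he ha hb hunit (hde u)
    (differentiableAt_fderiv_apply hf v) (hfb.mono fun p hp => hp v)
  have := sub_mem (hcov v u) (hcov u v)
  rwa [fderiv_fderiv_apply_comm hf u v, sub_sub_sub_cancel_left] at this

end NormalDirection

/-! ### Flatness of the asymptotic cone over an open set of the plane -/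

theorem exists_unit_span_eq {D n : Type*} [NormedAddCommGroup D] [NormedSpace ℝ D] [Fintype n]
    {B : D → n → ℂ} {Ω : Set D} (hB : ∀ q ∈ Ω, DifferentiableAt ℝ B q) (hB0 : ∀ q ∈ Ω, B q ≠ 0) :
    ∃ b : D → n → ℂ, ∀ q ∈ Ω,
      DifferentiableAt ℝ b q ∧ star (b q) ⬝ᵥ b q = 1 ∧ (ℂ ∙ b q) = ℂ ∙ B q := by
  let ν : D → ℝ := fun q => ‖(WithLp.toLp 2 (B q) : EuclideanSpace ℂ n)‖
  have hν0 : ∀ q ∈ Ω, (ν q : ℂ) ≠ 0 := fun q hq => by simpa [ν] using hB0 q hq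
  refine ⟨fun q => (ν q : ℂ)⁻¹ • B q, fun q hq => ⟨?_, ?_, ?_⟩⟩
  · have hνd : DifferentiableAt ℝ ν q := DifferentiableAt.norm ℂ
      ((PiLp.continuousLinearEquiv 2 ℝ fun _ : n => ℂ).symm.differentiableAt.comp q (hB q hq))
      (by simpa using hB0 q hq)
    exact ((Complex.ofRealCLM.differentiableAt.comp q hνd).inv (hν0 q hq)).smul (hB q hq)
  · have hself : star (B q) ⬝ᵥ B q = (ν q : ℂ) ^ 2 := by
      rw [dotProduct_comm, ← EuclideanSpace.inner_toLp_toLp, inner_self_eq_norm_sq_to_K]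
      rfl
    rw [star_smul, smul_dotProduct, dotProduct_smul, hself]
    simpa [field] using hν0 q hq
  · exact Submodule.span_singleton_smul_eq (inv_ne_zero (hν0 q hq)).isUnit _

/-- The orthonormal frame `F₁`, `F₂`, `b`, `i b` of the space spanned by `F₁ ∧ F₂` and a complex
normal direction. -/
def tangentFrame (F : Fin 8 → Oct) (b : Fin 3 → ℂ) : Fin 4 → Oct :=
  ![F 1, F 2, ofNormalCoord F b, ofNormalCoord F (Complex.I • b)]

section AdaptedFrame

variable {F : Fin 8 → Oct} (hF : IsAdaptedFrame F) {b : Fin 3 → ℂ}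
include hF

theorem IsAdaptedFrame.orthonormal_tangentFrame (hb : star b ⬝ᵥ b = 1) :
    Orthonormal ℝ (tangentFrame F b) := by
  have h1 := hF.inner_one_ofNormalCoord
  have h2 := hF.inner_two_ofNormalCoord
  have h1' : ∀ z, ⟪ofNormalCoord F z, F 1⟫_ℝ = 0 := fun z => by rw [real_inner_comm, h1]
  have h2' : ∀ z, ⟪ofNormalCoord F z, F 2⟫_ℝ = 0 := fun z => by rw [real_inner_comm, h2]
  have hnorm : ∀ z, star z ⬝ᵥ z = 1 → ‖ofNormalCoord F z‖ = 1 := fun z hz => by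
    rw [norm_eq_sqrt_real_inner, hF.inner_ofNormalCoord, hz, Complex.one_re, Real.sqrt_one]
  rw [orthonormal_iff_ite]
  intro i j
  fin_cases i <;> fin_cases j <;>
    simp [tangentFrame, h1, h2, h1', h2', hF.1.1, hF.inner_eq_ite, hF.inner_ofNormalCoord, hb,
      hnorm]

theorem IsAdaptedFrame.mem_span_tangentFrame {X : Oct} (h : normalCoord F X ∈ ℂ ∙ b) :
    X ∈ Submodule.span ℝ (Set.range (tangentFrame F b)) := by
  obtain ⟨τ, hτ⟩ := Submodule.mem_span_singleton.1 h
  rw [hF.eq_add_ofNormalCoord X, ← hτ, ofNormalCoord_smul]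
  have hmem : ∀ i, tangentFrame F b i ∈ Submodule.span ℝ (Set.range (tangentFrame F b)) :=
    fun i => Submodule.subset_span ⟨i, rfl⟩
  exact add_mem (add_mem (Submodule.smul_mem _ _ (hmem 0)) (Submodule.smul_mem _ _ (hmem 1)))
    (add_mem (Submodule.smul_mem _ _ (hmem 2)) (Submodule.smul_mem _ _ (hmem 3)))

theorem IsAdaptedFrame.mem_span_pair {X : Oct} (h : normalCoord F X = 0) :
    X ∈ Submodule.span ℝ (Set.range ![F 1, F 2]) := by
  have hzero : ofNormalCoord F 0 = 0 := by simp [ofNormalCoord]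
  rw [hF.eq_add_ofNormalCoord X, h, hzero, add_zero]
  exact add_mem (Submodule.smul_mem _ _ (Submodule.subset_span ⟨0, rfl⟩))
    (Submodule.smul_mem _ _ (Submodule.subset_span ⟨1, rfl⟩))

end AdaptedFrame

section MovingFrame

variable {D : Type*} [NormedAddCommGroup D] [NormedSpace ℝ D] {e : D → Fin 8 → Oct}
  {b : D → Fin 3 → ℂ}

theorem differentiableAt_tangentFrame {q : D} (he : ∀ i, DifferentiableAt ℝ (fun p => e p i) q)
    (hb : DifferentiableAt ℝ b q) (i : Fin 4) :
    DifferentiableAt ℝ (fun p => tangentFrame (e p) (b p) i) q := by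
  have hof : ∀ b : D → Fin 3 → ℂ, DifferentiableAt ℝ b q →
      DifferentiableAt ℝ (fun p => ofNormalCoord (e p) (b p)) q := fun b hb => by
    have hre : ∀ i, DifferentiableAt ℝ (fun p => (b p i).re) q := fun i =>
      Complex.reCLM.differentiableAt.comp q (differentiableAt_pi.1 hb i)
    have him : ∀ i, DifferentiableAt ℝ (fun p => (b p i).im) q := fun i =>
      Complex.imCLM.differentiableAt.comp q (differentiableAt_pi.1 hb i)
    unfold ofNormalCoord
    fun_prop
  fin_cases i
  exacts [he 1, he 2, hof b hb, hof _ (hb.const_smul Complex.I)]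

theorem tangentFrame_mem_span {Ω : Set D} (hΩ : IsOpen Ω) (hconn : IsPreconnected Ω)
    (he : ∀ i, ∀ q ∈ Ω, DifferentiableAt ℝ (fun p => e p i) q) (ha : ∀ q ∈ Ω, IsAdaptedFrame (e q))
    (hb : ∀ q ∈ Ω, DifferentiableAt ℝ b q) (hunit : ∀ q ∈ Ω, star (b q) ⬝ᵥ b q = 1)
    (hde : ∀ q ∈ Ω, ∀ u, ∀ k ∈ ({1, 2} : Finset (Fin 8)),
      normalCoord (e q) (fderiv ℝ (fun p => e p k) q u) ∈ ℂ ∙ b q)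
    (hcov : ∀ q ∈ Ω, ∀ u, covDeriv e b q u ∈ ℂ ∙ b q) {q₀ q : D} (hq₀ : q₀ ∈ Ω) (hq : q ∈ Ω)
    (i : Fin 4) :
    tangentFrame (e q) (b q) i ∈ Submodule.span ℝ (Set.range (tangentFrame (e q₀) (b q₀))) := by
  have hd := fun q hq => differentiableAt_tangentFrame (fun i => he i q hq) (hb q hq)
  refine mem_span_of_fderiv_mem_span (f := fun q => tangentFrame (e q) (b q)) hΩ hconn
    (fun i q hq => hd q hq i) (fun q hq => (ha q hq).orthonormal_tangentFrame (hunit q hq))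
    (fun q hq u i => (ha q hq).mem_span_tangentFrame ?_) hq₀ hq i
  have hnormal : ∀ i, (∀ p ∈ Ω, normalCoord (e p) (tangentFrame (e p) (b p) i) ∈ ℂ ∙ b p) →
      normalCoord (e q) (fderiv ℝ (fun p => tangentFrame (e p) (b p) i) q u) ∈ ℂ ∙ b q := by
    intro i hi
    have hev := fun {P : D → Prop} (h : ∀ p ∈ Ω, P p) => eventually_of_mem (hΩ.mem_nhds hq) h
    have hsub := normalCoord_fderiv_sub_mem_span (fun i => he i q hq) (hev ha) (hb q hq)
      (hev hunit) (hde q hq u) (hd q hq i) (hev hi)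
    exact (Submodule.sub_mem_iff_left _ (Submodule.smul_mem _ _ (hcov q hq u))).1 hsub
  fin_cases i
  · exact hde q hq u 1 (by decide)
  · exact hde q hq u 2 (by decide)
  · refine hnormal 2 fun p hp => ?_
    exact ((ha p hp).normalCoord_ofNormalCoord _).symm ▸ Submodule.mem_span_singleton_self _
  · refine hnormal 3 fun p hp => ?_
    exact ((ha p hp).normalCoord_ofNormalCoord _).symm ▸
      Submodule.smul_mem _ _ (Submodule.mem_span_singleton_self _)

theorem mem_span_pair_of_normalCoord_fderiv_eq_zero {Ω : Set D} (hΩ : IsOpen Ω)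
    (hconn : IsPreconnected Ω)
    (he : ∀ k ∈ ({1, 2} : Finset (Fin 8)), ∀ q ∈ Ω, DifferentiableAt ℝ (fun p => e p k) q)
    (ha : ∀ q ∈ Ω, IsAdaptedFrame (e q))
    (hde : ∀ q ∈ Ω, ∀ u, ∀ k ∈ ({1, 2} : Finset (Fin 8)),
      normalCoord (e q) (fderiv ℝ (fun p => e p k) q u) = 0) {q₀ q : D} (hq₀ : q₀ ∈ Ω) (hq : q ∈ Ω)
    (i : Fin 2) :
    ![e q 1, e q 2] i ∈ Submodule.span ℝ (Set.range ![e q₀ 1, e q₀ 2]) := by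
  refine mem_span_of_fderiv_mem_span (f := fun q => ![e q 1, e q 2]) hΩ hconn ?_ ?_
    (fun q hq u i => (ha q hq).mem_span_pair ?_) hq₀ hq i
  · intro i
    fin_cases i
    exacts [he 1 (by decide), he 2 (by decide)]
  · intro q hq
    rw [orthonormal_iff_ite]
    intro i j
    fin_cases i <;> fin_cases j <;> simp [(ha q hq).inner_eq_ite, (ha q hq).1.1]
  · fin_cases i
    exacts [hde q hq u 1 (by decide), hde q hq u 2 (by decide)]

end MovingFrame

/-- `-2i` times the `(0,1)`-part of the normal coordinates of `ds`, evaluated at the tangent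
vector `1`. -/
def dbarNormal (e : ℂ → Fin 8 → Oct) (s : ℂ → Oct) (q : ℂ) : Fin 3 → ℂ :=
  normalCoord (e q) (fderiv ℝ s q Complex.I) - Complex.I • normalCoord (e q) (fderiv ℝ s q 1)

section DbarNormal

variable {e : ℂ → Fin 8 → Oct} {s : ℂ → Oct}

theorem differentiableAt_dbarNormal {q : ℂ} (he : ∀ i, ContDiffAt ℝ 2 (fun p => e p i) q)
    (hs : ContDiffAt ℝ 2 s q) : DifferentiableAt ℝ (dbarNormal e s) q :=
  have hds := fun v => differentiableAt_normalCoord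
    (fun i => (he i).differentiableAt two_ne_zero) (differentiableAt_fderiv_apply hs v)
  (hds Complex.I).sub ((hds 1).const_smul Complex.I)

theorem normalCoord_fderiv_mem_span_dbarNormal {q : ℂ} (hs0 : dbarNormal e s q ≠ 0)
    (h : normalCoord (e q) (fderiv ℝ s q 1) ⨯₃ dbarNormal e s q = 0) (u : ℂ) :
    normalCoord (e q) (fderiv ℝ s q u) ∈ ℂ ∙ dbarNormal e s q := by
  have hone := mem_span_singleton_of_cross_eq_zero hs0 h
  have hI : normalCoord (e q) (fderiv ℝ s q Complex.I) ∈ ℂ ∙ dbarNormal e s q := by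
    rw [← sub_add_cancel (normalCoord (e q) (fderiv ℝ s q Complex.I)) (Complex.I • _)]
    exact add_mem (Submodule.mem_span_singleton_self _) (Submodule.smul_mem _ _ hone)
  have hu : u = u.re • (1 : ℂ) + u.im • Complex.I := by simp [Complex.re_add_im]
  rw [hu, map_add, map_add, map_smul, map_smul, map_smul, map_smul]
  exact add_mem (Submodule.smul_of_tower_mem _ _ hone) (Submodule.smul_of_tower_mem _ _ hI)

/-- Closedness of `de_k` gives `∇_u b ≡ u ∇_1 b` modulo `b`; a second relation, independent of this
one because `ds` is not of type `(1,0)`, comes from the closedness of `ds`. -/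
theorem covDeriv_mem_span {b : ℂ → Fin 3 → ℂ} {q : ℂ}
    (he : ∀ i, ContDiffAt ℝ 2 (fun p => e p i) q) (hs : ContDiffAt ℝ 2 s q)
    (ha : ∀ᶠ p in 𝓝 q, IsAdaptedFrame (e p)) (hb : DifferentiableAt ℝ b q)
    (hunit : ∀ᶠ p in 𝓝 q, star (b p) ⬝ᵥ b p = 1)
    (hde : ∀ᶠ p in 𝓝 q, ∀ u, ∀ k ∈ ({1, 2} : Finset (Fin 8)),
      normalCoord (e p) (fderiv ℝ (fun p => e p k) p u) ∈ ℂ ∙ b p)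
    (hds : ∀ᶠ p in 𝓝 q, ∀ u, normalCoord (e p) (fderiv ℝ s p u) ∈ ℂ ∙ b p)
    (hs0 : dbarNormal e s q ≠ 0) {k : Fin 8} (hk : k ∈ ({1, 2} : Finset (Fin 8)))
    (hhol : ∀ u, normalCoord (e q) (fderiv ℝ (fun p => e p k) q u)
      = u • normalCoord (e q) (fderiv ℝ (fun p => e p k) q 1))
    (hk0 : normalCoord (e q) (fderiv ℝ (fun p => e p k) q 1) ≠ 0) (u : ℂ) :
    covDeriv e b q u ∈ ℂ ∙ b q := by
  have hsymm := fun {f : ℂ → Oct} (hf : ContDiffAt ℝ 2 f q) hfb u =>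
    smul_covDeriv_sub_smul_covDeriv_mem_span (fun i => (he i).differentiableAt two_ne_zero) ha hb
      hunit hde.self_of_nhds hf hfb u 1
  have hcoef : ∀ z ∈ ℂ ∙ b q, z ≠ 0 → star (b q) ⬝ᵥ z ≠ 0 := fun z hz hz0 h0 =>
    hz0 (by rw [eq_dotProduct_smul_of_mem_span hunit.self_of_nhds hz, h0, zero_smul])
  have hframe : ∀ u, covDeriv e b q u - u • covDeriv e b q 1 ∈ ℂ ∙ b q := fun u => by
    have hu := hsymm (he k) (hde.mono fun p hp u => hp u k hk) u
    rw [hhol u, dotProduct_smul, smul_eq_mul, mul_comm, mul_smul, ← smul_sub] at hu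
    exact (Submodule.smul_mem_iff _ (hcoef _ (hde.self_of_nhds 1 k hk) hk0)).1 hu
  have hone : covDeriv e b q 1 ∈ ℂ ∙ b q := by
    have hmem : dbarNormal e s q ∈ ℂ ∙ b q := sub_mem (hds.self_of_nhds Complex.I)
      (Submodule.smul_mem _ _ (hds.self_of_nhds 1))
    refine (Submodule.smul_mem_iff _ (hcoef _ hmem hs0)).1 ?_
    have hsub := sub_mem (Submodule.smul_mem _ (star (b q) ⬝ᵥ normalCoord (e q) (fderiv ℝ s q 1))
      (hframe Complex.I)) (hsymm hs hds Complex.I)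
    convert hsub using 1
    rw [dbarNormal, dotProduct_sub, dotProduct_smul, smul_eq_mul]
    module
  rw [← sub_add_cancel (covDeriv e b q u) (u • covDeriv e b q 1)]
  exact add_mem (hframe u) (Submodule.smul_mem _ _ hone)

section FlatBall

variable {Ω : Set ℂ} (hΩ : IsOpen Ω) (he : ∀ i, ContDiffOn ℝ 2 (fun p => e p i) Ω)
  (hs : ContDiffOn ℝ 2 s Ω) (ha : ∀ q ∈ Ω, IsAdaptedFrame (e q))
  (hhol : ∀ q ∈ Ω, ∀ k ∈ ({1, 2} : Finset (Fin 8)), ∀ u,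
    normalCoord (e q) (fderiv ℝ (fun p => e p k) q u)
      = u • normalCoord (e q) (fderiv ℝ (fun p => e p k) q 1))
  (hs0 : ∀ q ∈ Ω, dbarNormal e s q ≠ 0)
  (hde : ∀ q ∈ Ω, ∀ k ∈ ({1, 2} : Finset (Fin 8)),
    normalCoord (e q) (fderiv ℝ (fun p => e p k) q 1) ⨯₃ dbarNormal e s q = 0)
  (hds : ∀ q ∈ Ω, normalCoord (e q) (fderiv ℝ s q 1) ⨯₃ dbarNormal e s q = 0)
include hΩ he hs ha hhol hs0 hde hds

theorem exists_tangentFrame_mem_span (hconn : IsPreconnected Ω) {k : Fin 8}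
    (hk : k ∈ ({1, 2} : Finset (Fin 8)))
    (hk0 : ∀ q ∈ Ω, normalCoord (e q) (fderiv ℝ (fun p => e p k) q 1) ≠ 0) :
    ∃ b : ℂ → Fin 3 → ℂ, ∀ q₀ ∈ Ω, ∀ q ∈ Ω, ∀ i,
      tangentFrame (e q) (b q) i ∈ Submodule.span ℝ (Set.range (tangentFrame (e q₀) (b q₀))) := by
  have heAt : ∀ q ∈ Ω, ∀ i, ContDiffAt ℝ 2 (fun p => e p i) q := fun q hq i =>
    (he i).contDiffAt (hΩ.mem_nhds hq)
  have hed : ∀ q ∈ Ω, ∀ i, DifferentiableAt ℝ (fun p => e p i) q := fun q hq i =>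
    (heAt q hq i).differentiableAt two_ne_zero
  have hsAt : ∀ q ∈ Ω, ContDiffAt ℝ 2 s q := fun q hq => hs.contDiffAt (hΩ.mem_nhds hq)
  obtain ⟨b, hb⟩ := exists_unit_span_eq
    (fun q hq => differentiableAt_dbarNormal (heAt q hq) (hsAt q hq)) hs0
  have hdeb : ∀ q ∈ Ω, ∀ u, ∀ k ∈ ({1, 2} : Finset (Fin 8)),
      normalCoord (e q) (fderiv ℝ (fun p => e p k) q u) ∈ ℂ ∙ b q := fun q hq u k hk => by
    rw [hhol q hq k hk u, (hb q hq).2.2]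
    exact Submodule.smul_mem _ _ (mem_span_singleton_of_cross_eq_zero (hs0 q hq) (hde q hq k hk))
  have hdsb : ∀ q ∈ Ω, ∀ u, normalCoord (e q) (fderiv ℝ s q u) ∈ ℂ ∙ b q := fun q hq u =>
    (hb q hq).2.2 ▸ normalCoord_fderiv_mem_span_dbarNormal (hs0 q hq) (hds q hq) u
  refine ⟨b, fun q₀ hq₀ q hq => tangentFrame_mem_span hΩ hconn (fun i q hq => hed q hq i) ha
    (fun q hq => (hb q hq).1) (fun q hq => (hb q hq).2.1) hdeb (fun q hq u => ?_) hq₀ hq⟩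
  have hev := fun {P : ℂ → Prop} (h : ∀ p ∈ Ω, P p) => eventually_of_mem (hΩ.mem_nhds hq) h
  exact covDeriv_mem_span (heAt q hq) (hsAt q hq) (hev ha) (hb q hq).1
    (hev fun p hp => (hb p hp).2.1) (hev hdeb) (hev hdsb) (hs0 q hq) hk (hhol q hq k hk)
    (hk0 q hq) u

theorem exists_flat_ball (hne : Ω.Nonempty) :
    ∃ (q₀ : ℂ) (r : ℝ), 0 < r ∧ Metric.ball q₀ r ⊆ Ω ∧ ∃ P : Submodule ℝ Oct,
      Module.finrank ℝ P ≤ 4 ∧ ∀ q ∈ Metric.ball q₀ r, e q 1 ∈ P ∧ e q 2 ∈ P := by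
  by_cases hflat : ∀ q ∈ Ω, ∀ k ∈ ({1, 2} : Finset (Fin 8)),
      normalCoord (e q) (fderiv ℝ (fun p => e p k) q 1) = 0
  · obtain ⟨q₀, hq₀⟩ := hne
    obtain ⟨r, hr, hball⟩ := Metric.isOpen_iff.1 hΩ q₀ hq₀
    have hmem := fun {q} hq => mem_span_pair_of_normalCoord_fderiv_eq_zero Metric.isOpen_ball
      (convex_ball q₀ r).isPreconnected
      (fun k _ q hq => ((he k).contDiffAt (hΩ.mem_nhds (hball hq))).differentiableAt two_ne_zero)
      (fun q hq => ha q (hball hq))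
      (fun q hq u k hk => by rw [hhol q (hball hq) k hk, hflat q (hball hq) k hk, smul_zero])
      (Metric.mem_ball_self hr) (q := q) hq
    exact ⟨q₀, r, hr, hball, _, (finrank_range_le_card _).trans (by simp),
      fun q hq => ⟨hmem hq 0, hmem hq 1⟩⟩
  · push Not at hflat
    obtain ⟨q₀, hq₀, k, hk, hk0⟩ := hflat
    have hcont : ContinuousAt (fun q => normalCoord (e q) (fderiv ℝ (fun p => e p k) q 1)) q₀ :=
      have heAt := fun i => (he i).contDiffAt (hΩ.mem_nhds hq₀)
      (differentiableAt_normalCoord (fun i => (heAt i).differentiableAt two_ne_zero)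
        (differentiableAt_fderiv_apply (heAt k) 1)).continuousAt
    obtain ⟨r, hr, hball⟩ := Metric.mem_nhds_iff.1
      (inter_mem (hΩ.mem_nhds hq₀) (hcont.eventually_ne hk0))
    have hsub : Metric.ball q₀ r ⊆ Ω := hball.trans Set.inter_subset_left
    obtain ⟨b, hmem⟩ := exists_tangentFrame_mem_span Metric.isOpen_ball
      (fun i => (he i).mono hsub) (hs.mono hsub) (fun q hq => ha q (hsub hq))
      (fun q hq => hhol q (hsub hq)) (fun q hq => hs0 q (hsub hq)) (fun q hq => hde q (hsub hq))
      (fun q hq => hds q (hsub hq)) (convex_ball q₀ r).isPreconnected hk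
      (fun q hq => (hball hq).2)
    have hmem₀ := hmem q₀ (Metric.mem_ball_self hr)
    exact ⟨q₀, r, hr, hsub, _, (finrank_range_le_card _).trans (by simp),
      fun q hq => ⟨hmem₀ q hq 0, hmem₀ q hq 1⟩⟩

end FlatBall

end DbarNormal

section Charts

variable {S : Type*} [TopologicalSpace S] [ChartedSpace ℂ S]
variable {W : Type*} [NormedAddCommGroup W] [NormedSpace ℝ W] {f : S → W} {p p₀ : S}

theorem differentiableAt_comp_chartAt_symm (hf : MDifferentiableAt 𝓘(ℝ, ℂ) 𝓘(ℝ, W) f p) :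
    DifferentiableAt ℝ (f ∘ (chartAt ℂ p).symm) (chartAt ℂ p p) := by
  have h : DifferentiableWithinAt ℝ (f ∘ (chartAt ℂ p).symm) (Set.range id) (chartAt ℂ p p) :=
    ((mdifferentiableAt_iff f p).1 hf).2
  rwa [Set.range_id, differentiableWithinAt_univ] at h

theorem diff_apply (hf : MDifferentiableAt 𝓘(ℝ, ℂ) 𝓘(ℝ, W) f p) (v : Tan p) :
    diff f p v = fderiv ℝ (f ∘ (chartAt ℂ p).symm) (chartAt ℂ p p) v := by
  have h : diff f p v
      = fderivWithin ℝ (f ∘ (chartAt ℂ p).symm) (Set.range id) (chartAt ℂ p p) v :=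
    congrArg (fun L : TangentSpace 𝓘(ℝ, ℂ) p →L[ℝ] TangentSpace 𝓘(ℝ, W) (f p) => L v) hf.mfderiv
  rw [h, Set.range_id, fderivWithin_univ]

/-- The curve through `p` with velocity `v` that is a straight line in the chart at `p`. -/
def curve (p : S) (v : Tan p) (t : ℝ) : S :=
  let z : ℂ := v
  (chartAt ℂ p).symm (chartAt ℂ p p + t • z)

theorem curve_zero (p : S) (v : Tan p) : curve p v 0 = p := by
  let z : ℂ := v
  have h : (chartAt ℂ p).symm (chartAt ℂ p p + (0 : ℝ) • z) = p := by simp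
  exact h

theorem tendsto_curve (p : S) (v : Tan p) : Tendsto (curve p v) (𝓝 0) (𝓝 p) := by
  let z : ℂ := v
  have hline : ContinuousAt (fun t : ℝ => chartAt ℂ p p + t • z) 0 := by fun_prop
  have hchart : ContinuousAt (chartAt ℂ p).symm (chartAt ℂ p p + (0 : ℝ) • z) := by
    rw [zero_smul, add_zero]
    exact (chartAt ℂ p).symm.continuousAt (mem_chart_target ℂ p)
  have h : ContinuousAt (curve p v) 0 :=
    ContinuousAt.comp (f := fun t : ℝ => chartAt ℂ p p + t • z) hchart hline
  rwa [ContinuousAt, curve_zero] at h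

theorem hasDerivAt_curve (hf : MDifferentiableAt 𝓘(ℝ, ℂ) 𝓘(ℝ, W) f p) (v : Tan p) :
    HasDerivAt (fun t => f (curve p v t)) (diff f p v) 0 := by
  rw [diff_apply hf]
  exact (differentiableAt_comp_chartAt_symm hf).hasFDerivAt.hasLineDerivAt v

section RiemannSurface

variable [IsManifold 𝓘(ℂ) ω S]

theorem isManifold_real : IsManifold 𝓘(ℝ, ℂ) ∞ S := by
  refine isManifold_of_contDiffOn _ _ _ fun χ χ' h h' => ?_
  have htransition := (contDiffGroupoid ω 𝓘(ℂ)).compatible h h'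
  rw [contDiffGroupoid, mem_groupoid_of_pregroupoid] at htransition
  have hcomplex : ContDiffOn ℂ ω (χ' ∘ χ.symm) (χ.symm ≫ₕ χ').source := by
    simpa [contDiffPregroupoid] using htransition.1
  simpa using (hcomplex.restrict_scalars ℝ).of_le (m := ∞) (by simp)

theorem diff_eq_fderiv_diff_chartAt (hp : p ∈ (chartAt ℂ p₀).source)
    (hf : MDifferentiableAt 𝓘(ℝ, ℂ) 𝓘(ℝ, W) f p) (v : Tan p) :
    diff f p v
      = fderiv ℝ (f ∘ (chartAt ℂ p₀).symm) (chartAt ℂ p₀ p) (diff (chartAt ℂ p₀) p v) := by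
  set φ := chartAt ℂ p₀
  have : IsManifold 𝓘(ℝ, ℂ) 1 S := isManifold_real.of_le (by simp)
  have hφ : MDifferentiableAt 𝓘(ℝ, ℂ) 𝓘(ℝ, ℂ) φ p :=
    mdifferentiableAt_atlas (chart_mem_atlas ℂ p₀) hp
  have hsymm : MDifferentiableAt 𝓘(ℝ, ℂ) 𝓘(ℝ, ℂ) φ.symm (φ p) :=
    mdifferentiableAt_atlas_symm (chart_mem_atlas ℂ p₀) (φ.map_source hp)
  have hfφ : MDifferentiableAt 𝓘(ℝ, ℂ) 𝓘(ℝ, W) (f ∘ φ.symm) (φ p) :=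
    MDifferentiableAt.comp (φ p) (by rwa [φ.left_inv hp]) hsymm
  have heq : (f ∘ φ.symm) ∘ φ =ᶠ[𝓝 p] f := by
    filter_upwards [φ.open_source.mem_nhds hp] with q hq
    simp only [Function.comp_apply, φ.left_inv hq]
  have hchain : diff f p = (mfderiv 𝓘(ℝ, ℂ) 𝓘(ℝ, W) (f ∘ φ.symm) (φ p)).comp (diff φ p) :=
    heq.mfderiv_eq.symm.trans (mfderiv_comp p hfφ hφ)
  rw [hchain, mfderiv_eq_fderiv]
  rfl

theorem diff_chartAt_rot (hp : p ∈ (chartAt ℂ p₀).source) (v : Tan p) :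
    diff (chartAt ℂ p₀) p (rot p v) = Complex.I * diff (chartAt ℂ p₀) p v := by
  set φ := chartAt ℂ p₀
  set χ := chartAt ℂ p
  have : IsManifold 𝓘(ℝ, ℂ) 1 S := isManifold_real.of_le (by simp)
  have : IsManifold 𝓘(ℂ) 1 S := IsManifold.of_le (n := ω) (by simp)
  have hφ : MDifferentiableAt 𝓘(ℂ) 𝓘(ℂ) φ p := mdifferentiableAt_atlas (chart_mem_atlas ℂ p₀) hp
  have hcomplex : DifferentiableAt ℂ (φ ∘ χ.symm) (χ p) := by
    have h : DifferentiableWithinAt ℂ (φ ∘ χ.symm) (Set.range id) (χ p) :=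
      ((mdifferentiableAt_iff φ p).1 hφ).2
    rwa [Set.range_id, differentiableWithinAt_univ] at h
  have hdiff : ∀ w : Tan p, diff φ p w = fderiv ℂ (φ ∘ χ.symm) (χ p) w := fun w => by
    rw [diff_apply (mdifferentiableAt_atlas (chart_mem_atlas ℂ p₀) hp),
      hcomplex.fderiv_restrictScalars ℝ]
    rfl
  rw [hdiff, hdiff]
  exact (fderiv ℂ (φ ∘ χ.symm) (χ p)).map_smul Complex.I v

theorem surjective_diff_chartAt (hp : p ∈ (chartAt ℂ p₀).source) :
    Function.Surjective (diff (chartAt ℂ p₀) p) :=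
  have : IsManifold 𝓘(ℝ, ℂ) 1 S := isManifold_real.of_le (by simp)
  (mdifferentiable_chart (I := 𝓘(ℝ, ℂ)) p₀).mfderiv_surjective hp

end RiemannSurface

end Charts

/-! ### Adapted framings of pseudoholomorphic curves -/

theorem inner_eq_zero_of_mem_orthogonal_plane_wedge {u v x : Oct} (hu : ‖u‖ = 1) (hv : ‖v‖ = 1)
    (huv : ⟪u, v⟫_ℝ = 0) (hx : x ∈ (plane (wedge u v))ᗮ) : ⟪u, x⟫_ℝ = 0 ∧ ⟪v, x⟫_ℝ = 0 := by
  have hwedge_v : wedge u v v = u := by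
    simp [wedge, hv, huv]
  have hwedge_u : wedge u v u = -v := by
    simp [wedge, hu, real_inner_comm, huv]
  have hu_mem : u ∈ plane (wedge u v) := ⟨v, hwedge_v⟩
  have hv_mem : v ∈ plane (wedge u v) := neg_mem_iff.1 ⟨u, hwedge_u⟩
  exact ⟨hx u hu_mem, hx v hv_mem⟩

theorem plane_wedge_le {u v : Oct} {P : Submodule ℝ Oct} (hu : u ∈ P) (hv : v ∈ P) :
    plane (wedge u v) ≤ P := by
  rintro _ ⟨y, rfl⟩
  simp only [wedge, ContinuousLinearMap.coe_coe, sub_apply, ContinuousLinearMap.smulRight_apply]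
  exact sub_mem (Submodule.smul_mem _ _ hu) (Submodule.smul_mem _ _ hv)

theorem hasDerivAt_wedge_apply {u v : ℝ → Oct} {u' v' : Oct} {t : ℝ} (hu : HasDerivAt u u' t)
    (hv : HasDerivAt v v' t) (x : Oct) :
    HasDerivAt (fun s => wedge (u s) (v s) x) (wedge u' (v t) x + wedge (u t) v' x) t := by
  have hprod := ((hv.inner ℝ (hasDerivAt_const t x)).smul hu).sub
    ((hu.inner ℝ (hasDerivAt_const t x)).smul hv)
  refine hprod.congr_deriv ?_
  simp only [wedge, sub_apply, ContinuousLinearMap.smulRight_apply, innerSL_apply_apply,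
    inner_zero_right, zero_add]
  abel

theorem complexCoord_congr {x y : Fin 8 → ℝ} (h : ∀ a, a ≠ 1 → a ≠ 2 → x a = y a) :
    complexCoord x = complexCoord y := by
  simp only [complexCoord_apply, h 3 (by decide) (by decide), h 4 (by decide) (by decide),
    h 5 (by decide) (by decide), h 6 (by decide) (by decide), h 7 (by decide) (by decide),
    h 8 (by decide) (by decide)]

section Surface

variable {S : Type*} [TopologicalSpace S] [ChartedSpace ℂ S]

namespace AdaptedFraming

variable {γ : S → Oct →L[ℝ] Oct} {U : TopologicalSpace.Opens S} (e : AdaptedFraming γ U)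

/-- The differential of a map followed by the projection to `γ(p)^⊥ ≅ ℂ³`. -/
def normalDiff (f : S → Oct) (p : S) : Tan p →L[ℝ] (Fin 3 → ℂ) :=
  (normalCoord (e.vec p)).comp (diff f p)

/-- The value of the matrix `(ω_{ij})` on a tangent vector. -/
def connMat (p : S) (v : Tan p) : Matrix (Fin 8) (Fin 8) ℝ :=
  frameVelocity (e.vec p) fun i => diff (fun q => e.vec q i) p v

variable {p : S} {s : S → Oct}

theorem mdifferentiableAt_vec (hp : p ∈ U) (i : Fin 8) :
    MDifferentiableAt 𝓘(ℝ, ℂ) 𝓘(ℝ, Oct) (fun q => e.vec q i) p :=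
  ((e.smooth i).contMDiffAt (U.isOpen.mem_nhds hp)).mdifferentiableAt (by simp)

theorem mdifferentiableAt_section (hs : s ∈ sectionsH γ U) (hp : p ∈ U) :
    MDifferentiableAt 𝓘(ℝ, ℂ) 𝓘(ℝ, Oct) s p :=
  (hs.1.contMDiffAt (U.isOpen.mem_nhds hp)).mdifferentiableAt (by simp)

theorem mdifferentiableAt_comp (hs : s ∈ sectionsH γ U) (hp : p ∈ U) (a : Fin 8) :
    MDifferentiableAt 𝓘(ℝ, ℂ) 𝓘(ℝ, ℝ) (e.comp s a) p :=
  ((e.contMDiffOn_comp ⟨s, hs⟩ a).contMDiffAt (U.isOpen.mem_nhds hp)).mdifferentiableAt (by simp)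

theorem hasDerivAt_vec_curve (hp : p ∈ U) (v : Tan p) (i : Fin 8) :
    HasDerivAt (fun t => e.vec (curve p v t) i) (diff (fun q => e.vec q i) p v) 0 :=
  hasDerivAt_curve (e.mdifferentiableAt_vec hp i) v

theorem eventually_mem_curve (hp : p ∈ U) (v : Tan p) : ∀ᶠ t in 𝓝 (0 : ℝ), curve p v t ∈ U :=
  (tendsto_curve p v).eventually (U.isOpen.mem_nhds hp)

theorem eventually_isAdaptedFrame_curve (hp : p ∈ U) (v : Tan p) :
    ∀ᶠ t in 𝓝 (0 : ℝ), IsAdaptedFrame (e.vec (curve p v t)) :=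
  (eventually_mem_curve hp v).mono fun _ => e.adapted _

theorem inner_vec_section_eq_zero (hs : s ∈ sectionsH γ U) (hp : p ∈ U) :
    ⟪e.vec p 1, s p⟫_ℝ = 0 ∧ ⟪e.vec p 2, s p⟫_ℝ = 0 := by
  have ha := e.adapted p hp
  refine inner_eq_zero_of_mem_orthogonal_plane_wedge (ha.1.1 1) (ha.1.1 2)
    (ha.1.2 (by decide)) ?_
  rw [e.span p hp]
  exact hs.2 p hp

theorem sPrime_apply (hs : s ∈ sectionsH γ U) (hp : p ∈ U) (a : Fin 8) (v : Tan p) :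
    e.sPrime s a p v = (⟪e.vec p a, diff s p v⟫_ℝ : ℂ) := by
  have hcomp := (hasDerivAt_curve (e.mdifferentiableAt_comp hs hp a) v).unique
    (hasDerivAt_inner_frame (e.eventually_isAdaptedFrame_curve hp v) (e.hasDerivAt_vec_curve hp v)
      (hasDerivAt_curve (mdifferentiableAt_section hs hp) v) a)
  rw [curve_zero] at hcomp
  have hsum : (e.connMat p v *ᵥ fun b => ⟪e.vec p b, s p⟫_ℝ) a
      = ∑ b ∈ ({3, 4, 5, 6, 7, 8} : Finset (Fin 8)), e.comp s b p * e.conn a b p v := by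
    have huniv : (Finset.univ : Finset (Fin 8)) = insert 1 (insert 2 {3, 4, 5, 6, 7, 8}) := by
      decide
    rw [Matrix.mulVec, dotProduct, huniv, Finset.sum_insert (by decide),
      Finset.sum_insert (by decide), (e.inner_vec_section_eq_zero hs hp).1,
      (e.inner_vec_section_eq_zero hs hp).2, mul_zero, mul_zero, zero_add, zero_add]
    exact Finset.sum_congr rfl fun b _ => mul_comm _ _
  simp only [sPrime, toC, ContinuousLinearMap.comp_apply, add_apply, sum_apply, smul_apply,
    smul_eq_mul, hcomp, ← hsum, Complex.ofRealCLM_apply]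
  exact congrArg Complex.ofReal (sub_add_cancel _ _)

theorem normalDiff_section (hs : s ∈ sectionsH γ U) (hp : p ∈ U) (v : Tan p) (i : Fin 3) :
    e.normalDiff s p v i = e.alpha s i p v := by
  fin_cases i <;>
    simp only [alpha, Fin.reduceFinMk, Matrix.cons_val, add_apply, sub_apply, smul_apply,
      sPrime_apply _ hs hp] <;>
    rfl

theorem normalCoord_section (i : Fin 3) : normalCoord (e.vec p) (s p) i = e.coef s i p := by
  fin_cases i <;> rfl

theorem kappa_apply (v : Tan p) (i j : Fin 3) :
    e.kappa p i j v = kappaMat (e.connMat p v) i j := by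
  fin_cases i <;> fin_cases j <;> rfl

theorem sum_mul_bracketThetaBar (z : Fin 3 → ℂ) (v : Tan p) (i : Fin 3) :
    ∑ j, z j * e.bracketThetaBar p i j v = (z ⨯₃ star (thetaVec (e.connMat p v))) i := by
  have hbar : bar (e.theta1 p) v = star (thetaVec (e.connMat p v)) 0
      ∧ bar (e.theta3 p) v = star (thetaVec (e.connMat p v)) 1
      ∧ bar (e.theta5 p) v = star (thetaVec (e.connMat p v)) 2 := ⟨rfl, rfl, rfl⟩
  obtain ⟨h1, h3, h5⟩ := hbar
  fin_cases i <;>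
    simp [bracketThetaBar, Fin.sum_univ_three, cross_apply, -Pi.star_apply, h1, h3, h5] <;> ring

theorem alpha_eq (hs : s ∈ sectionsH γ U) (hp : p ∈ U) (i : Fin 3) :
    e.alpha s i p = diff (e.coef s i) p + ∑ j, e.coef s j p • e.kappa p i j
      + (Complex.I / 2) • ∑ j, (starRingEnd ℂ) (e.coef s j p) • e.bracketThetaBar p i j := by
  ext v
  have hcoef : HasDerivAt (fun t => normalCoord (e.vec (curve p v t)) (s (curve p v t)))
      (fun j => diff (e.coef s j) p v) 0 := by
    refine hasDerivAt_pi.2 fun j => ?_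
    simp only [normalCoord_section]
    exact hasDerivAt_curve (e.mdiff_coef ⟨s, hs⟩ j hp) v
  have hds := normalCoord_deriv_eq (e.eventually_isAdaptedFrame_curve hp v)
    (e.hasDerivAt_vec_curve hp v) (hasDerivAt_curve (mdifferentiableAt_section hs hp) v) hcoef
  rw [curve_zero, (e.inner_vec_section_eq_zero hs hp).1, (e.inner_vec_section_eq_zero hs hp).2,
    zero_smul, zero_smul, zero_add, zero_add] at hds
  have hkappa : ∑ j, e.coef s j p * e.kappa p i j v
      = (kappaMat (e.connMat p v) *ᵥ normalCoord (e.vec p) (s p)) i := by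
    simp only [kappa_apply, Matrix.mulVec, dotProduct, normalCoord_section, mul_comm]
  have hbracket : ∑ j, (starRingEnd ℂ) (e.coef s j p) * e.bracketThetaBar p i j v
      = (star (normalCoord (e.vec p) (s p)) ⨯₃ star (thetaVec (e.connMat p v))) i := by
    simp only [← sum_mul_bracketThetaBar, Pi.star_apply, normalCoord_section]
    rfl
  rw [← e.normalDiff_section hs hp]
  simp only [add_apply, smul_apply, sum_apply, smul_eq_mul, hkappa, hbracket]
  rw [add_assoc]
  exact congrFun hds i

theorem diff_wedge_apply (hγ : MDifferentiableAt 𝓘(ℝ, ℂ) 𝓘(ℝ, Oct →L[ℝ] Oct) γ p) (hp : p ∈ U)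
    (v : Tan p) (x : Oct) :
    diff γ p v x = wedge (diff (fun q => e.vec q 1) p v) (e.vec p 2) x
      + wedge (e.vec p 1) (diff (fun q => e.vec q 2) p v) x := by
  have hγ_curve : HasDerivAt (fun t => γ (curve p v t) x) (diff γ p v x) 0 :=
    (ContinuousLinearMap.apply ℝ Oct x).hasFDerivAt.comp_hasDerivAt 0 (hasDerivAt_curve hγ v)
  have hwedge := hasDerivAt_wedge_apply (e.hasDerivAt_vec_curve hp v 1)
    (e.hasDerivAt_vec_curve hp v 2) x
  rw [curve_zero] at hwedge
  refine hγ_curve.unique (hwedge.congr_of_eventuallyEq ?_)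
  filter_upwards [eventually_mem_curve hp v] with t ht
  rw [← e.span _ ht]

theorem grOne_apply (hγ : MDifferentiableAt 𝓘(ℝ, ℂ) 𝓘(ℝ, Oct →L[ℝ] Oct) γ p) (hp : p ∈ U)
    (v : Tan p) {j : Fin 8} (hj₁ : j ≠ 1) (hj₂ : j ≠ 2) :
    grOne γ (e.vec p) j p v = e.connMat p v j 1 := by
  have ha := e.adapted p hp
  change ⟪e.vec p j, diff γ p v (e.vec p 2)⟫_ℝ = ⟪e.vec p j, diff (fun q => e.vec q 1) p v⟫_ℝ
  rw [e.diff_wedge_apply hγ hp]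
  simp [wedge, inner_add_right, inner_sub_right, inner_smul_right, ha.inner_eq_ite, ha.1.1, hj₁,
    hj₂]

theorem grTwo_apply (hγ : MDifferentiableAt 𝓘(ℝ, ℂ) 𝓘(ℝ, Oct →L[ℝ] Oct) γ p) (hp : p ∈ U)
    (v : Tan p) {j : Fin 8} (hj₁ : j ≠ 1) (hj₂ : j ≠ 2) :
    grTwo γ (e.vec p) j p v = e.connMat p v j 2 := by
  have ha := e.adapted p hp
  change -⟪e.vec p j, diff γ p v (e.vec p 1)⟫_ℝ = ⟪e.vec p j, diff (fun q => e.vec q 2) p v⟫_ℝ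
  rw [e.diff_wedge_apply hγ hp]
  simp [wedge, inner_add_right, inner_sub_right, inner_smul_right, ha.inner_eq_ite, ha.1.1, hj₁,
    hj₂]

theorem normalDiff_vec_rot (hγ : IsPseudoholomorphic γ) (hp : p ∈ U) (v : Tan p) {k : Fin 8}
    (hk : k ∈ ({1, 2} : Finset (Fin 8))) :
    e.normalDiff (fun q => e.vec q k) p (rot p v)
      = Complex.I • e.normalDiff (fun q => e.vec q k) p v := by
  have hd : MDifferentiableAt 𝓘(ℝ, ℂ) 𝓘(ℝ, Oct →L[ℝ] Oct) γ p :=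
    (hγ.1 p).mdifferentiableAt (by simp)
  obtain ⟨h3, h6, h5, h4, h7, h8⟩ := hγ.2.2 p (e.vec p) (e.adapted p hp) (e.span p hp)
  have hone : ∀ u : Tan p, e.normalDiff (fun q => e.vec q 1) p u
      = complexCoord fun j => grOne γ (e.vec p) j p u := fun u =>
    complexCoord_congr fun j hj₁ hj₂ => (e.grOne_apply hd hp u hj₁ hj₂).symm
  have htwo : ∀ u : Tan p, e.normalDiff (fun q => e.vec q 2) p u
      = complexCoord fun j => grTwo γ (e.vec p) j p u := fun u =>
    complexCoord_congr fun j hj₁ hj₂ => (e.grTwo_apply hd hp u hj₁ hj₂).symm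
  simp only [Finset.mem_insert, Finset.mem_singleton] at hk
  rcases hk with rfl | rfl
  · rw [hone, hone]
    ext i
    fin_cases i
    exacts [h3 v, h6 v, h5 v]
  · rw [htwo, htwo]
    ext i
    fin_cases i
    exacts [h4 v, h7 v, h8 v]

end AdaptedFraming

end Surface

/-! ### The Cayley equations of a 2-ruled fourfold -/

theorem alternatingMap_eq_zero_of_mem_span {R M ι : Type*} [CommRing R] [AddCommGroup M]
    [Module R M] [Finite ι] (f : M [⋀^ι]→ₗ[R] R) {x y : ι → M} (hy : f y = 0)
    (hx : ∀ i, x i ∈ Submodule.span R (Set.range y)) : f x = 0 := by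
  classical
  have := Fintype.ofFinite ι
  choose c hc using fun i => (Submodule.mem_span_range_iff_exists_fun R).1 (hx i)
  let g := f.compLinearMap (Fintype.linearCombination R y)
  have hg : g = 0 := (g.map_basis_eq_zero_iff (Pi.basisFun R ι)).1 <| by
    simpa [g, Fintype.linearCombination_apply_single] using hy
  calc f x = g c := congrArg f (funext fun i => (hc i).symm)
    _ = 0 := by rw [hg, AlternatingMap.zero_apply]

section Surface

variable {S : Type*} [TopologicalSpace S] [ChartedSpace ℂ S] {p : S}

theorem cross_comm_of_rot {A B : Tan p →L[ℝ] (Fin 3 → ℂ)}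
    (hA : ∀ v, A (rot p v) = Complex.I • A v) (hB : ∀ v, B (rot p v) = Complex.I • B v)
    (u v : Tan p) : A u ⨯₃ B v = A v ⨯₃ B u := by
  have hlinear : ∀ L : ℂ →L[ℝ] (Fin 3 → ℂ), (∀ z, L (Complex.I • z) = Complex.I • L z) →
      ∀ z, L z = z • L 1 := fun L hL z => by
    have hI : L Complex.I = Complex.I • L 1 := by simpa using hL 1
    simpa using real_linearMap_map_smul_complex (ℓ := L.toLinearMap) hI z 1
  let A' : ℂ →L[ℝ] (Fin 3 → ℂ) := A
  let B' : ℂ →L[ℝ] (Fin 3 → ℂ) := B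
  have h : ∀ z w : ℂ, A' z ⨯₃ B' w = A' w ⨯₃ B' z := fun z w => by
    simp only [hlinear A' hA z, hlinear A' hA w, hlinear B' hB z, hlinear B' hB w, map_smul,
      LinearMap.smul_apply, smul_comm z w]
  exact h u v

namespace AdaptedFraming

variable {γ : S → Oct →L[ℝ] Oct} {U : TopologicalSpace.Opens S} (e : AdaptedFraming γ U)
  {s : S → Oct}

/-- The differential along the surface of the map `r₁ e₁ + r₂ e₂ + s` for fixed `r₁`, `r₂`. -/
def transverse (s : S → Oct) (r₁ r₂ : ℝ) (p : S) : Tan p →L[ℝ] Oct :=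
  r₁ • diff (fun q => e.vec q 1) p + r₂ • diff (fun q => e.vec q 2) p + diff s p

theorem mdifferentiableAt_ruled (hs : s ∈ sectionsH γ U) (r₁ r₂ : ℝ) (hp : p ∈ U) :
    MDifferentiableAt (𝓘(ℝ, ℝ).prod (𝓘(ℝ, ℝ).prod 𝓘(ℝ, ℂ))) 𝓘(ℝ, Oct) (e.ruled s)
      (r₁, r₂, p) := by
  have hproj : MDifferentiableAt (𝓘(ℝ, ℝ).prod (𝓘(ℝ, ℝ).prod 𝓘(ℝ, ℂ))) 𝓘(ℝ, ℂ)
      (fun q : ℝ × ℝ × S => q.2.2) (r₁, r₂, p) := mdifferentiableAt_snd.snd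
  have hone := (e.mdifferentiableAt_vec hp 1).comp (r₁, r₂, p) hproj
  have htwo := (e.mdifferentiableAt_vec hp 2).comp (r₁, r₂, p) hproj
  have hsec := (mdifferentiableAt_section hs hp).comp (r₁, r₂, p) hproj
  exact ((mdifferentiableAt_fst.smul hone).add (mdifferentiableAt_snd.fst.smul htwo)).add hsec

theorem mfderiv_ruled (hs : s ∈ sectionsH γ U) (r₁ r₂ : ℝ) (hp : p ∈ U) (a b : ℝ) (v : Tan p) :
    (mfderiv (𝓘(ℝ, ℝ).prod (𝓘(ℝ, ℝ).prod 𝓘(ℝ, ℂ))) 𝓘(ℝ, Oct) (e.ruled s) (r₁, r₂, p)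
        ((a, b, v) : ℝ × ℝ × ℂ) : Oct)
      = a • e.vec p 1 + b • e.vec p 2 + e.transverse s r₁ r₂ p v := by
  have hruled := e.mdifferentiableAt_ruled hs r₁ r₂ hp
  have hruled' : MDifferentiableAt (𝓘(ℝ, ℝ).prod 𝓘(ℝ, ℂ)) 𝓘(ℝ, Oct)
      (fun q : ℝ × S => e.ruled s (r₁, q)) (r₂, p) :=
    hruled.comp (r₂, p) (mdifferentiableAt_const.prodMk mdifferentiableAt_id)
  have hfirst : mfderiv 𝓘(ℝ, ℝ) 𝓘(ℝ, Oct) (fun x => e.ruled s (x, r₂, p)) r₁ a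
      = a • e.vec p 1 := by
    have h := ((ContinuousLinearMap.toSpanSingleton ℝ (e.vec p 1)).hasFDerivAt (x := r₁)).add_const
      (r₂ • e.vec p 2) |>.add_const (s p)
    exact DFunLike.congr_fun h.hasMFDerivAt.mfderiv a
  have hsecond : mfderiv 𝓘(ℝ, ℝ) 𝓘(ℝ, Oct) (fun y => e.ruled s (r₁, y, p)) r₂ b
      = b • e.vec p 2 := by
    have h := ((ContinuousLinearMap.toSpanSingleton ℝ (e.vec p 2)).hasFDerivAt (x := r₂)).const_add
      (r₁ • e.vec p 1) |>.add_const (s p)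
    exact DFunLike.congr_fun h.hasMFDerivAt.mfderiv b
  have hthird : diff (fun q => e.ruled s (r₁, r₂, q)) p = e.transverse s r₁ r₂ p := by
    have h₁ := e.mdifferentiableAt_vec hp 1
    have h₂ := e.mdifferentiableAt_vec hp 2
    have h := ((h₁.const_smul r₁).add (h₂.const_smul r₂)).hasMFDerivAt.add
      (mdifferentiableAt_section hs hp).hasMFDerivAt
    rw [mfderiv_add (h₁.const_smul r₁) (h₂.const_smul r₂), const_smul_mfderiv h₁,
      const_smul_mfderiv h₂] at h
    exact h.mfderiv
  refine (mfderiv_prod_eq_add_apply (v := ((a, b, v) : ℝ × ℝ × ℂ)) hruled).trans ?_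
  refine (congrArg₂ (· + ·) hfirst
    ((mfderiv_prod_eq_add_apply (v := ((b, v) : ℝ × ℂ)) hruled').trans
      (congrArg₂ (· + ·) hsecond (DFunLike.congr_fun hthird v)))).trans ?_
  exact (add_assoc _ _ _).symm

theorem isCayley_iff_transverse (hs : s ∈ sectionsH γ U) :
    e.IsCayley s ↔ ∀ p ∈ U, ∀ (r₁ r₂ : ℝ) (u v : Tan p) (m : Fin 7),
      psi m (e.vec p 1) (e.vec p 2) (e.transverse s r₁ r₂ p u) (e.transverse s r₁ r₂ p v) = 0 := by
  constructor
  · intro h p hp r₁ r₂ u v m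
    have hone := e.mfderiv_ruled hs r₁ r₂ hp 1 0 0
    have htwo := e.mfderiv_ruled hs r₁ r₂ hp 0 1 0
    have hu := e.mfderiv_ruled hs r₁ r₂ hp 0 0 u
    have hv := e.mfderiv_ruled hs r₁ r₂ hp 0 0 v
    simp only [one_smul, zero_smul, add_zero, zero_add, map_zero] at hone htwo hu hv
    rw [← hone, ← htwo, ← hu, ← hv]
    exact h (r₁, r₂, p) hp m ![((1, 0, (0 : ℂ)) : ℝ × ℝ × ℂ), ((0, 1, (0 : ℂ)) : ℝ × ℝ × ℂ),
      ((0, 0, u) : ℝ × ℝ × ℂ), ((0, 0, v) : ℝ × ℝ × ℂ)]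
  · rintro h ⟨r₁, r₂, p⟩ hp m x D
    let T : ℂ →L[ℝ] Oct := e.transverse s r₁ r₂ p
    have hT : ∀ z : ℂ, T z = z.re • T 1 + z.im • T Complex.I := fun z => by
      rw [← map_smul, ← map_smul, ← map_add, Complex.real_smul, Complex.real_smul, mul_one,
        Complex.re_add_im]
    have hy : psiAlt m ![e.vec p 1, e.vec p 2, T 1, T Complex.I] = 0 := by
      rw [psiAlt_apply]
      exact h p hp r₁ r₂ (1 : ℂ) Complex.I m
    have hx : ∀ z : ℝ × ℝ × ℂ,
        D z ∈ Submodule.span ℝ (Set.range ![e.vec p 1, e.vec p 2, T 1, T Complex.I]) := fun z => by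
      have hD : D z = z.1 • e.vec p 1 + z.2.1 • e.vec p 2 + T z.2.2 :=
        e.mfderiv_ruled hs r₁ r₂ hp z.1 z.2.1 z.2.2
      refine (Submodule.mem_span_range_iff_exists_fun ℝ).2
        ⟨![z.1, z.2.1, z.2.2.re, z.2.2.im], ?_⟩
      rw [hD, hT z.2.2, Fin.sum_univ_four, ← add_assoc]
      rfl
    have hzero := alternatingMap_eq_zero_of_mem_span (psiAlt m) hy fun i => hx (x i)
    rwa [psiAlt_apply] at hzero

theorem normalCoord_transverse (s : S → Oct) (r₁ r₂ : ℝ) (v : Tan p) :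
    normalCoord (e.vec p) (e.transverse s r₁ r₂ p v)
      = r₁ • e.normalDiff (fun q => e.vec q 1) p v
        + r₂ • e.normalDiff (fun q => e.vec q 2) p v + e.normalDiff s p v := by
  simp only [transverse, add_apply, smul_apply, map_add, map_smul]
  rfl

/-- The reduced equations in normal coordinates, where `ψ(e₁, e₂, ·, ·)` becomes the cross product
of `ℂ³`. -/
def CrossEquations (s : S → Oct) : Prop :=
  ∀ p ∈ U, ∀ u v : Tan p,
    e.normalDiff s p u ⨯₃ e.normalDiff s p v = 0 ∧
    ∀ k ∈ ({1, 2} : Finset (Fin 8)),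
      e.normalDiff (fun q => e.vec q k) p u ⨯₃ e.normalDiff s p v
        = e.normalDiff (fun q => e.vec q k) p v ⨯₃ e.normalDiff s p u

theorem reducedEquations_iff_crossEquations (s : S → Oct) :
    e.ReducedEquations s ↔ e.CrossEquations s := by
  refine forall₂_congr fun p hp => ?_
  have ha := e.adapted p hp
  rw [forall_comm]
  refine forall_congr' fun u => ?_
  rw [forall_comm]
  refine forall_congr' fun v => ?_
  simp only [sub_eq_zero, forall_and]
  refine and_congr (ha.psi_eq_zero_iff _ _) ?_
  rw [forall_comm]
  refine forall_congr' fun k => ?_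
  rw [forall_comm]
  exact forall_congr' fun _ => ha.psi_eq_iff _ _ _ _

theorem cross_transverse (hγ : IsPseudoholomorphic γ) (hp : p ∈ U) (s : S → Oct) (r₁ r₂ : ℝ)
    (u v : Tan p) :
    normalCoord (e.vec p) (e.transverse s r₁ r₂ p u)
        ⨯₃ normalCoord (e.vec p) (e.transverse s r₁ r₂ p v)
      = e.normalDiff s p u ⨯₃ e.normalDiff s p v
        + r₁ • (e.normalDiff (fun q => e.vec q 1) p u ⨯₃ e.normalDiff s p v
          - e.normalDiff (fun q => e.vec q 1) p v ⨯₃ e.normalDiff s p u)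
        + r₂ • (e.normalDiff (fun q => e.vec q 2) p u ⨯₃ e.normalDiff s p v
          - e.normalDiff (fun q => e.vec q 2) p v ⨯₃ e.normalDiff s p u) := by
  have hrot : ∀ k ∈ ({1, 2} : Finset (Fin 8)), ∀ w : Tan p, _ := fun k hk w =>
    e.normalDiff_vec_rot hγ hp w hk
  have hone := hrot 1 (by decide)
  have htwo := hrot 2 (by decide)
  have hself : ∀ {A : Tan p →L[ℝ] (Fin 3 → ℂ)},
      (∀ w, A (rot p w) = Complex.I • A w) → A u ⨯₃ A v = 0 := fun {A} hA =>
    self_eq_neg.1 ((cross_comm_of_rot hA hA u v).trans (cross_anticomm _ _).symm)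
  have hmixed := cross_comm_of_rot hone htwo u v
  rw [← cross_anticomm (e.normalDiff (fun q => e.vec q 2) p u)] at hmixed
  simp only [normalCoord_transverse, map_add, LinearMap.map_smul_of_tower,
    LinearMap.add_apply, LinearMap.smul_apply, hself hone, hself htwo,
    ← cross_anticomm _ (e.normalDiff s p u)]
  linear_combination (norm := module) (r₁ * r₂) • hmixed

/-- The pull-back of `ψ` is the affine function of `(r₁, r₂)` in `cross_transverse`, hence vanishes
if and only if its three coefficients do. -/
theorem isCayley_iff_crossEquations (hγ : IsPseudoholomorphic γ) (hs : s ∈ sectionsH γ U) :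
    e.IsCayley s ↔ e.CrossEquations s := by
  have hcross : e.IsCayley s ↔ ∀ p ∈ U, ∀ (r₁ r₂ : ℝ) (u v : Tan p),
      normalCoord (e.vec p) (e.transverse s r₁ r₂ p u)
        ⨯₃ normalCoord (e.vec p) (e.transverse s r₁ r₂ p v) = 0 :=
    (e.isCayley_iff_transverse hs).trans <| forall₂_congr fun p hp =>
      forall₄_congr fun _ _ _ _ => (e.adapted p hp).psi_eq_zero_iff _ _
  rw [hcross]
  refine forall₂_congr fun p hp => ?_
  simp only [e.cross_transverse hγ hp]
  constructor
  · intro h u v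
    have hs_s : e.normalDiff s p u ⨯₃ e.normalDiff s p v = 0 := by simpa using h 0 0 u v
    refine ⟨hs_s, fun k hk => ?_⟩
    simp only [Finset.mem_insert, Finset.mem_singleton] at hk
    rcases hk with rfl | rfl
    · simpa [hs_s, sub_eq_zero] using h 1 0 u v
    · simpa [hs_s, sub_eq_zero] using h 0 1 u v
  · intro h r₁ r₂ u v
    rw [(h u v).1, (h u v).2 1 (by decide), (h u v).2 2 (by decide)]
    simp only [sub_self, smul_zero, add_zero]

theorem crossEquations_of_rot (hγ : IsPseudoholomorphic γ)
    (h : ∀ p ∈ U, ∀ v, e.normalDiff s p (rot p v) = Complex.I • e.normalDiff s p v) :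
    e.CrossEquations s := fun p hp u v =>
  ⟨self_eq_neg.1 ((cross_comm_of_rot (h p hp) (h p hp) u v).trans (cross_anticomm _ _).symm),
    fun _ hk => cross_comm_of_rot (fun w => e.normalDiff_vec_rot hγ hp w hk) (h p hp) u v⟩

end AdaptedFraming

end Surface

/-! ### Local analysis in a chart -/

section Surface

variable {S : Type*} [TopologicalSpace S] [ChartedSpace ℂ S]

theorem contDiffOn_comp_chartAt_symm [IsManifold 𝓘(ℂ) ω S] {W : Type*}
    [NormedAddCommGroup W] [NormedSpace ℝ W]
    {U : Set S} {f : S → W} (hf : ContMDiffOn 𝓘(ℝ, ℂ) 𝓘(ℝ, W) ∞ f U) (p₀ : S) :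
    ContDiffOn ℝ ∞ (f ∘ (chartAt ℂ p₀).symm)
      ((chartAt ℂ p₀).target ∩ (chartAt ℂ p₀).symm ⁻¹' U) := by
  have : IsManifold 𝓘(ℝ, ℂ) ∞ S := isManifold_real
  rw [← contMDiffOn_iff_contDiffOn]
  exact hf.comp (contMDiffOn_chart_symm.mono Set.inter_subset_left) fun q hq => hq.2

namespace AdaptedFraming

variable {γ : S → Oct →L[ℝ] Oct} {U : TopologicalSpace.Opens S} (e : AdaptedFraming γ U)
  {s : S → Oct} {p p₀ : S}

/-- The framing, expressed in the chart at `p₀`. -/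
def chartVec (p₀ : S) (q : ℂ) : Fin 8 → Oct := e.vec ((chartAt ℂ p₀).symm q)

/-- The normal coordinates of the differential of `f`, expressed in the chart at `p₀`. -/
def chartNormalDiff (f : S → Oct) (p₀ : S) (q : ℂ) : ℂ →L[ℝ] (Fin 3 → ℂ) :=
  (normalCoord (e.chartVec p₀ q)).comp (fderiv ℝ (f ∘ (chartAt ℂ p₀).symm) q)

theorem isFlatOn_of_chartVec_mem {r : ℝ} {q₀ : ℂ} {P : Submodule ℝ Oct}
    (hP : Module.finrank ℝ P ≤ 4)
    (hU : Metric.ball q₀ r ⊆ (chartAt ℂ p₀).symm ⁻¹' U)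
    (hmem : ∀ q ∈ Metric.ball q₀ r, e.chartVec p₀ q 1 ∈ P ∧ e.chartVec p₀ q 2 ∈ P) :
    IsFlatOn γ ((chartAt ℂ p₀).source ∩ chartAt ℂ p₀ ⁻¹' Metric.ball q₀ r) := by
  refine ⟨P, hP, fun p ⟨hp, hpball⟩ => ?_⟩
  have hpU : (chartAt ℂ p₀).symm (chartAt ℂ p₀ p) ∈ U := hU hpball
  obtain ⟨hone, htwo⟩ := hmem _ hpball
  rw [chartVec, (chartAt ℂ p₀).left_inv hp] at hone htwo
  rw [(chartAt ℂ p₀).left_inv hp] at hpU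
  rw [← e.span p hpU]
  exact plane_wedge_le hone htwo

variable [IsManifold 𝓘(ℂ) ω S] {f : S → Oct}

theorem normalDiff_eq_chartNormalDiff (hp : p ∈ (chartAt ℂ p₀).source)
    (hf : MDifferentiableAt 𝓘(ℝ, ℂ) 𝓘(ℝ, Oct) f p) (v : Tan p) :
    e.normalDiff f p v
      = e.chartNormalDiff f p₀ (chartAt ℂ p₀ p) (diff (chartAt ℂ p₀) p v) := by
  change normalCoord (e.vec p) (diff f p v) = normalCoord (e.vec _) _
  rw [(chartAt ℂ p₀).left_inv hp, diff_eq_fderiv_diff_chartAt hp hf]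
  rfl

theorem normalDiff_rot_of_dbarNormal_eq_zero (hp : p ∈ (chartAt ℂ p₀).source)
    (hf : MDifferentiableAt 𝓘(ℝ, ℂ) 𝓘(ℝ, Oct) f p)
    (h : dbarNormal (e.chartVec p₀) (f ∘ (chartAt ℂ p₀).symm) (chartAt ℂ p₀ p) = 0) (v : Tan p) :
    e.normalDiff f p (rot p v) = Complex.I • e.normalDiff f p v := by
  rw [normalDiff_eq_chartNormalDiff e hp hf, normalDiff_eq_chartNormalDiff e hp hf,
    diff_chartAt_rot hp]
  exact real_linearMap_map_smul_complex
    (ℓ := (e.chartNormalDiff f p₀ (chartAt ℂ p₀ p)).toLinearMap) (sub_eq_zero.1 h) _ _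

theorem exists_normalDiff_eq_chartNormalDiff_one {q : ℂ} (hq : q ∈ (chartAt ℂ p₀).target) :
    ∃ v : Tan ((chartAt ℂ p₀).symm q), ∀ {f : S → Oct},
      MDifferentiableAt 𝓘(ℝ, ℂ) 𝓘(ℝ, Oct) f ((chartAt ℂ p₀).symm q) →
      e.normalDiff f _ v = e.chartNormalDiff f p₀ q 1 ∧
      e.normalDiff f _ (rot _ v) = e.chartNormalDiff f p₀ q Complex.I := by
  have hp := (chartAt ℂ p₀).map_target hq
  obtain ⟨v, hv⟩ := surjective_diff_chartAt hp (1 : ℂ)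
  refine ⟨v, fun hf => ?_⟩
  rw [normalDiff_eq_chartNormalDiff e hp hf, normalDiff_eq_chartNormalDiff e hp hf,
    diff_chartAt_rot hp, hv, mul_one, (chartAt ℂ p₀).right_inv hq]
  exact ⟨rfl, rfl⟩

theorem chartNormalDiff_vec (hγ : IsPseudoholomorphic γ) {q : ℂ}
    (hq : q ∈ (chartAt ℂ p₀).target ∩ (chartAt ℂ p₀).symm ⁻¹' U) {k : Fin 8}
    (hk : k ∈ ({1, 2} : Finset (Fin 8))) (u : ℂ) :
    e.chartNormalDiff (fun p => e.vec p k) p₀ q u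
      = u • e.chartNormalDiff (fun p => e.vec p k) p₀ q 1 := by
  obtain ⟨v, hv⟩ := e.exists_normalDiff_eq_chartNormalDiff_one hq.1
  obtain ⟨hone, hI⟩ := hv (e.mdifferentiableAt_vec hq.2 k)
  have hrot := e.normalDiff_vec_rot hγ hq.2 v hk
  rw [hone, hI] at hrot
  simpa using real_linearMap_map_smul_complex
    (ℓ := (e.chartNormalDiff (fun p => e.vec p k) p₀ q).toLinearMap) hrot u 1

theorem cross_dbarNormal_eq_zero (hγ : IsPseudoholomorphic γ) (hs : s ∈ sectionsH γ U)
    (h : e.CrossEquations s) {q : ℂ}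
    (hq : q ∈ (chartAt ℂ p₀).target ∩ (chartAt ℂ p₀).symm ⁻¹' U) :
    e.chartNormalDiff s p₀ q 1 ⨯₃ dbarNormal (e.chartVec p₀) (s ∘ (chartAt ℂ p₀).symm) q = 0 ∧
    ∀ k ∈ ({1, 2} : Finset (Fin 8)), e.chartNormalDiff (fun p => e.vec p k) p₀ q 1
        ⨯₃ dbarNormal (e.chartVec p₀) (s ∘ (chartAt ℂ p₀).symm) q = 0 := by
  obtain ⟨v, hv⟩ := e.exists_normalDiff_eq_chartNormalDiff_one hq.1
  obtain ⟨hs_one, hs_I⟩ := hv (mdifferentiableAt_section hs hq.2)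
  obtain ⟨hss, hes⟩ := h _ hq.2 v (rot _ v)
  have hdbar : dbarNormal (e.chartVec p₀) (s ∘ (chartAt ℂ p₀).symm) q
      = e.normalDiff s _ (rot _ v) - Complex.I • e.normalDiff s _ v := by
    rw [hs_one, hs_I]
    rfl
  rw [hdbar, ← hs_one]
  refine ⟨by rw [map_sub, map_smul, hss, cross_self, smul_zero, sub_zero], fun k hk => ?_⟩
  rw [← (hv (e.mdifferentiableAt_vec hq.2 k)).1, map_sub, map_smul, hes k hk,
    e.normalDiff_vec_rot hγ hq.2 v hk, map_smul, LinearMap.smul_apply, sub_self]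

theorem contDiffOn_chartVec (p₀ : S) (i : Fin 8) :
    ContDiffOn ℝ 2 (fun q => e.chartVec p₀ q i)
      ((chartAt ℂ p₀).target ∩ (chartAt ℂ p₀).symm ⁻¹' U) :=
  (contDiffOn_comp_chartAt_symm (e.smooth i) p₀).of_le ENat.LEInfty.out

theorem continuousOn_dbarNormal_chartVec (hs : s ∈ sectionsH γ U) (p₀ : S) :
    ContinuousOn (dbarNormal (e.chartVec p₀) (s ∘ (chartAt ℂ p₀).symm))
      ((chartAt ℂ p₀).target ∩ (chartAt ℂ p₀).symm ⁻¹' U) := fun q hq => by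
  have hnhds := ((chartAt ℂ p₀).symm.isOpen_inter_preimage U.isOpen).mem_nhds hq
  exact (differentiableAt_dbarNormal (fun i => (e.contDiffOn_chartVec p₀ i).contDiffAt hnhds)
    (((contDiffOn_comp_chartAt_symm hs.1 p₀).of_le ENat.LEInfty.out).contDiffAt
      hnhds)).continuousAt.continuousWithinAt

theorem exists_isFlatOn (hγ : IsPseudoholomorphic γ) (hs : s ∈ sectionsH γ U)
    (h : e.CrossEquations s) (hp₀ : p₀ ∈ U) {v₀ : Tan p₀}
    (hv₀ : e.normalDiff s p₀ (rot p₀ v₀) ≠ Complex.I • e.normalDiff s p₀ v₀) :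
    ∃ V : Set S, V ⊆ U ∧ IsOpen V ∧ V.Nonempty ∧ IsFlatOn γ V := by
  set φ := chartAt ℂ p₀
  let Ω : Set ℂ := (φ.target ∩ φ.symm ⁻¹' U) ∩
    dbarNormal (e.chartVec p₀) (s ∘ φ.symm) ⁻¹' {0}ᶜ
  have hΩ : IsOpen Ω := (e.continuousOn_dbarNormal_chartVec hs p₀).isOpen_inter_preimage
    (φ.symm.isOpen_inter_preimage U.isOpen) isOpen_compl_singleton
  have hne : Ω.Nonempty := by
    have hp₀φ : p₀ ∈ φ.source := mem_chart_source ℂ p₀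
    refine ⟨φ p₀, ⟨mem_chart_target ℂ p₀, ?_⟩, fun hB₀ => hv₀ ?_⟩
    · rwa [Set.mem_preimage, φ.left_inv hp₀φ]
    · exact e.normalDiff_rot_of_dbarNormal_eq_zero hp₀φ (mdifferentiableAt_section hs hp₀) hB₀ v₀
  obtain ⟨q₀, r, hr, hball, P, hP, hmem⟩ := exists_flat_ball hΩ
    (fun i => (e.contDiffOn_chartVec p₀ i).mono Set.inter_subset_left)
    (((contDiffOn_comp_chartAt_symm hs.1 p₀).of_le ENat.LEInfty.out).mono Set.inter_subset_left)
    (fun q hq => e.adapted _ hq.1.2) (fun q hq _ hk => e.chartNormalDiff_vec hγ hq.1 hk)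
    (fun q hq => hq.2) (fun q hq => (e.cross_dbarNormal_eq_zero hγ hs h hq.1).2)
    (fun q hq => (e.cross_dbarNormal_eq_zero hγ hs h hq.1).1) hne
  have hballU : Metric.ball q₀ r ⊆ φ.symm ⁻¹' (U : Set S) := fun q hq => (hball hq).1.2
  refine ⟨φ.source ∩ φ ⁻¹' Metric.ball q₀ r, fun p hp => ?_,
    φ.isOpen_inter_preimage Metric.isOpen_ball, ?_, e.isFlatOn_of_chartVec_mem hP hballU hmem⟩
  · simpa [φ.left_inv hp.1] using hballU hp.2
  · have hq₀ := (hball (Metric.mem_ball_self hr)).1.1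
    exact ⟨φ.symm q₀, φ.map_target hq₀, by simpa [φ.right_inv hq₀] using hr⟩

end AdaptedFraming

end Surface

/-! ### The operator `∂̄ + π^{(0,1)} κ + (i/2) [θ̄]` -/

section Surface

variable {S : Type*} [TopologicalSpace S] [ChartedSpace ℂ S] {p : S}

theorem piZeroOne_apply (b : Tan p →L[ℝ] ℂ) (v : Tan p) :
    piZeroOne b v = (1 / 2) * (b v + Complex.I * b (rot p v)) :=
  rfl

theorem piZeroOne_add (b c : Tan p →L[ℝ] ℂ) : piZeroOne (b + c) = piZeroOne b + piZeroOne c := by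
  ext v
  simp only [piZeroOne_apply, add_apply]
  ring

theorem piZeroOne_smul (z : ℂ) (b : Tan p →L[ℝ] ℂ) : piZeroOne (z • b) = z • piZeroOne b := by
  ext v
  simp only [piZeroOne_apply, smul_apply, smul_eq_mul]
  ring

theorem isOneZero_iff_piZeroOne_eq_zero (b : Tan p →L[ℝ] ℂ) : IsOneZero b ↔ piZeroOne b = 0 := by
  rw [DFunLike.ext_iff]
  refine forall_congr' fun v => ?_
  rw [piZeroOne_apply, zero_apply]
  constructor <;> intro h
  · linear_combination (Complex.I / 2) * h + (1 / 2) * b v * Complex.I_mul_I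
  · linear_combination (-2 * Complex.I) * h + b (rot p v) * Complex.I_mul_I

theorem piZeroOne_eq_self {b : Tan p →L[ℝ] ℂ} (hb : ∀ v, b (rot p v) = -Complex.I * b v) :
    piZeroOne b = b := by
  ext v
  rw [piZeroOne_apply, hb]
  linear_combination (-1 / 2) * b v * Complex.I_mul_I

namespace AdaptedFraming

variable {γ : S → Oct →L[ℝ] Oct} {U : TopologicalSpace.Opens S} (e : AdaptedFraming γ U)
  {s : S → Oct}

theorem isOneZero_alpha_iff (hs : s ∈ sectionsH γ U) (hp : p ∈ U) :
    (∀ i, IsOneZero (e.alpha s i p)) ↔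
      ∀ v, e.normalDiff s p (rot p v) = Complex.I • e.normalDiff s p v := by
  simp only [IsOneZero, ← e.normalDiff_section hs hp]
  rw [forall_comm]
  exact forall_congr' fun v => funext_iff.symm

theorem isCayley_iff_isOneZero_alpha [IsManifold 𝓘(ℂ) ω S] (hγ : IsPseudoholomorphic γ)
    (hflat : ∀ V : Set S, V ⊆ U → IsOpen V → V.Nonempty → ¬ IsFlatOn γ V)
    (hs : s ∈ sectionsH γ U) :
    e.IsCayley s ↔ ∀ p ∈ U, ∀ i : Fin 3, IsOneZero (e.alpha s i p) := by
  rw [e.isCayley_iff_crossEquations hγ hs]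
  constructor
  · intro h p hp
    refine (e.isOneZero_alpha_iff hs hp).2 fun v => ?_
    by_contra hv
    obtain ⟨V, hVU, hV, hne, hVflat⟩ := e.exists_isFlatOn hγ hs h hp hv
    exact hflat V hVU hV hne hVflat
  · exact fun h => e.crossEquations_of_rot hγ fun p hp => (e.isOneZero_alpha_iff hs hp).1 (h p hp)

theorem thetaVec_connMat_rot (hγ : IsPseudoholomorphic γ) (hp : p ∈ U) (v : Tan p) :
    thetaVec (e.connMat p (rot p v)) = Complex.I • thetaVec (e.connMat p v) := by
  change e.normalDiff (fun q => e.vec q 1) p (rot p v)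
      + Complex.I • e.normalDiff (fun q => e.vec q 2) p (rot p v)
    = Complex.I • (e.normalDiff (fun q => e.vec q 1) p v
      + Complex.I • e.normalDiff (fun q => e.vec q 2) p v)
  rw [e.normalDiff_vec_rot hγ hp v (by decide), e.normalDiff_vec_rot hγ hp v (by decide), smul_add]

theorem piZeroOne_bracketThetaBar (hγ : IsPseudoholomorphic γ) (hp : p ∈ U) (i j : Fin 3) :
    piZeroOne (e.bracketThetaBar p i j) = e.bracketThetaBar p i j := by
  have hentry : ∀ v : Tan p, e.bracketThetaBar p i j v
      = (Pi.single j 1 ⨯₃ star (thetaVec (e.connMat p v))) i := fun v => by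
    rw [← sum_mul_bracketThetaBar]
    simp [Pi.single_apply]
  refine piZeroOne_eq_self fun v => ?_
  rw [hentry, hentry, e.thetaVec_connMat_rot hγ hp, star_smul, map_smul, Pi.smul_apply,
    smul_eq_mul, Complex.star_def, Complex.conj_I]

theorem dbarOperator_apply (hγ : IsPseudoholomorphic γ) (s : sectionsH γ U) (p : U) (i : Fin 3) :
    e.dbarOperator s p i = piZeroOne (e.alpha s.1 i p) := by
  rw [e.alpha_eq s.2 p.2]
  simp only [Fin.sum_univ_three, piZeroOne_add, piZeroOne_smul,
    e.piZeroOne_bracketThetaBar hγ p.2]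
  simp [dbarOperator, Fin.sum_univ_three]

theorem dbarOperator_eq_zero_iff (hγ : IsPseudoholomorphic γ) (s : sectionsH γ U) :
    e.dbarOperator s = 0 ↔ ∀ p ∈ U, ∀ i : Fin 3, IsOneZero (e.alpha s.1 i p) := by
  simp only [funext_iff, Subtype.forall, e.dbarOperator_apply hγ, Pi.zero_apply,
    isOneZero_iff_piZeroOne_eq_zero]

end AdaptedFraming

end Surface

end

end Cayley

theorem mainTheorem7 {S : Type*} [TopologicalSpace S] [ChartedSpace ℂ S] [IsManifold 𝓘(ℂ) ω S]
    (γ : S → Cayley.Oct →L[ℝ] Cayley.Oct) (hγ : Cayley.IsPseudoholomorphic γ)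
    (U : TopologicalSpace.Opens S) (e : Cayley.AdaptedFraming γ U)
    (hflat : ∀ V : Set S, V ⊆ U → IsOpen V → V.Nonempty → ¬ Cayley.IsFlatOn γ V) :
    (∀ s ∈ Cayley.sectionsH γ U,
      (∀ p ∈ U, ∀ i : Fin 3,
        e.alpha s i p = Cayley.diff (e.coef s i) p + ∑ j, e.coef s j p • e.kappa p i j
          + (Complex.I / 2) • ∑ j, (starRingEnd ℂ) (e.coef s j p) • e.bracketThetaBar p i j) ∧
      (e.IsCayley s ↔ e.ReducedEquations s) ∧
      (e.IsCayley s ↔ ∀ p ∈ U, ∀ i : Fin 3, Cayley.IsOneZero (e.alpha s i p))) ∧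
    {s : Cayley.sectionsH γ U | e.IsCayley s} = (LinearMap.ker e.dbarOperator : Set _) := by
  refine ⟨fun s hs => ⟨fun p hp i => e.alpha_eq hs hp i, ?_, ?_⟩, ?_⟩
  · rw [e.isCayley_iff_crossEquations hγ hs, e.reducedEquations_iff_crossEquations]
  · exact e.isCayley_iff_isOneZero_alpha hγ hflat hs
  · ext s
    rw [Set.mem_ofPred_eq, e.isCayley_iff_isOneZero_alpha hγ hflat s.2, SetLike.mem_coe,
      LinearMap.mem_ker, e.dbarOperator_eq_zero_iff hγ]
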